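/- Let $d\ge 1$, let $S$ be a finite set with the discrete topology and the counting measure, and put $\Omega_\Lambda=S^\Lambda$ for finite $\Lambda\subset\mathbb Z^d$. Let $\Phi=(\Phi_A)$ be a potential, i.e. a function $\Phi_A:\Omega_A\to\mathbb R$ for every non-empty finite $A\subset\mathbb Z^d$, with Hamiltonians $H_\Lambda(\omega)=\sum_{\emptyset\ne A\subset\Lambda}\Phi_A(\omega|_A)$. Let $\Lambda_n=[-n,n]^d\cap\mathbb Z^d$ and define, with $\log 0=-\infty$, $$\psi(\beta)=\lim_{n\to\infty}-\frac1{|\Lambda_n|}\log\sum_{\omega\in\Omega_{\Lambda_n}}e^{-\beta H_{\Lambda_n}(\omega)},$$ $$s(u)=\lim_{r\to0^+}\lim_{n\to\infty}\frac1{|\Lambda_n|}\log\Big|\Big\{\omega\in\Omega_{\Lambda_n}:\tfrac{H_{\Lambda_n}(\omega)}{|\Lambda_n|}\in(u-r,u+r)\Big\}\Big|,$$ $$\sigma(u)=\lim_{n\to\infty}\frac1{|\Lambda_n|}\log|\chi(M_n(u))|,\qquad M_n(u)=\{\omega\in\Omega_{\Lambda_n}:H_{\Lambda_n}(\omega)\le|\Lambda_n|u\},$$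 where $\chi$ is the Euler characteristic. A function is called $k$ times differentiable at a point if it is $k-1$ times differentiable near the point and its $(k-1)$-st derivative is differentiable at the point ($0$ times differentiable being no condition). The system has a phase transition of order $p\ge1$ at $\beta>0$ if $\psi$ is $(p-1)$ but not $p$ times differentiable at $\beta$. Assume that $\Phi$ is translation invariant ($\Phi_{A+x}(\omega)=\Phi_A((\omega_{y+x})_{y\in A})$ for all $x$, $A$ and $\omega\in\Omega_{A+x}$), absolutely summable ($\sum_{A\ni0}\sup_\omega|\Phi_A(\omega)|<\infty$), non-constant (some $\Phi_A$ is a non-constant function) and positively correlated: for all finite $\Lambda$, all non-empty $A,B\subset\Lambda$ and all $\beta>0$, the covariance of $\omega\mapsto\Phi_A(\omega|_A)$ and $\omega\mapsto\Phi_B(\omega|_B)$ under the Gibbs distribution on $\Omega_\Lambda$, proportional to $e^{-\beta H_\Lambda(\omega)}$, is non-negative. Assume moreover that there is no phase transition of order $1$ at any $\beta>0$. Then there are real numbers $a<b$ such that the limits defining $\psi$ on $(0,\infty)$ and $s,\sigma$ on $(a,b)$ exist and are finite, and: (i) $\psi:(0,\infty)\to\mathbb R$ and $s:(a,b)\to\mathbb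 R$ are differentiable and are Legendre–Fenchel duals, that is, $\psi(\beta)=\inf_{u\in(a,b)}(\beta u-s(u))$ for $\beta>0$ and $s(u)=\inf_{\beta>0}(\beta u-\psi(\beta))$ for $u\in(a,b)$; and $\psi':(0,\infty)\to(a,b)$ and $s':(a,b)\to(0,\infty)$ are mutually inverse continuous maps. (ii) $\sigma=s$ on $(a,b)$. Furthermore, for all $u\in(a,b)$ and $\beta=s'(u)>0$: (iii) there is a phase transition of order $2$ at $\beta$ if and only if $\sigma$ is not twice differentiable at $u$ or $\sigma''(u)=0$; (iv) for every integer $p>2$, there is a phase transition of order $p$ at $\beta$ if and only if $\sigma$ is $(p-1)$ but not $p$ times differentiable at $u$ and $\sigma''(u)\ne0$. -/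

import Mathlib

open Filter Topology Set

noncomputable section

namespace LatticeSpin

universe u

/-- The sites of the lattice `ℤ^d`. -/
abbrev Site (d : ℕ) : Type := Fin d → ℤ

/-- The configuration space `Ω_Λ = S^Λ` (with the product topology if `S` is a space). -/
abbrev Config {d : ℕ} (S : Type u) (Λ : Finset (Site d)) : Type u := ↥Λ → S

/-- An interaction potential: a function `Φ_A : Ω_A → ℝ` for each finite `A ⊆ ℤ^d`. Only the
non-empty `A` matter: the component at `∅` is ignored by every definition below. (For finite
discrete `S` every function on `Ω_A` is measurable.) -/
abbrev Potential (d : ℕ) (S : Type u) : Type u := (A : Finset (Site d)) → Config S A → ℝ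

variable {d : ℕ} {S : Type u}

/-- The translate `{y + x : y ∈ A}`. -/
def translate (x : Site d) (A : Finset (Site d)) : Finset (Site d) :=
  A.map (addRightEmbedding x)

/-- Pulling a configuration on the translate `A + x` back to `A`: `y ↦ ω (y + x)`. -/
def pullback (x : Site d) (A : Finset (Site d)) (ω : Config S (translate x A)) : Config S A :=
  fun y => ω ⟨y.1 + x, Finset.mem_map_of_mem (addRightEmbedding x) y.2⟩

/-- Translation invariance of the potential. -/
def TranslationInvariant (Φ : Potential d S) : Prop :=
  ∀ (x : Site d) (A : Finset (Site d)), A.Nonempty →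
    ∀ ω : Config S (translate x A), Φ (translate x A) ω = Φ A (pullback x A ω)

/-- The supremum norm `‖Φ_A‖` (for finite `S` the supremum is over a finite set). -/
def supNorm (Φ : Potential d S) (A : Finset (Site d)) : ℝ := ⨆ ω : Config S A, |Φ A ω|

/-- Absolute summability: `∑_{A ∋ 0} ‖Φ_A‖ < ∞`. -/
def AbsolutelySummable (Φ : Potential d S) : Prop :=
  Summable fun A : {A : Finset (Site d) // (0 : Site d) ∈ A} => supNorm Φ A.1

/-- The potential is non-constant: some `Φ_A` is a non-constant function. -/
def NonConstant (Φ : Potential d S) : Prop :=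
  ∃ A : Finset (Site d), A.Nonempty ∧ ∃ ω ω' : Config S A, Φ A ω ≠ Φ A ω'

/-- The extension of `Φ_A` to `Ω_Λ` for `A ⊆ Λ`, namely `ω ↦ Φ_A(ω_A)`; it is only used for
`A ⊆ Λ`. -/
def extend (Φ : Potential d S) (Λ A : Finset (Site d)) (ω : Config S Λ) : ℝ :=
  open Classical in
  if h : A ⊆ Λ then Φ A (Finset.restrict₂ (π := fun _ => S) h ω) else 0

/-- The Hamiltonian `H_Λ(ω) = ∑_{∅ ≠ A ⊆ Λ} Φ_A(ω_A)` (free boundary conditions). -/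
def hamiltonian (Φ : Potential d S) (Λ : Finset (Site d)) (ω : Config S Λ) : ℝ :=
  ∑ A ∈ Λ.powerset with A.Nonempty, extend Φ Λ A ω

/-- The partition function `Z_{Λ,β}` with respect to the counting measure. -/
def partitionFunction [Fintype S] (Φ : Potential d S) (Λ : Finset (Site d)) (β : ℝ) : ℝ :=
  ∑ ω : Config S Λ, Real.exp (-β * hamiltonian Φ Λ ω)

/-- The Gibbs expectation `⟨f⟩_{Λ,β}`. -/
def gibbsExpectation [Fintype S] (Φ : Potential d S) (Λ : Finset (Site d)) (β : ℝ)
    (f : Config S Λ → ℝ) : ℝ :=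
  ∑ ω : Config S Λ, f ω * (Real.exp (-β * hamiltonian Φ Λ ω) / partitionFunction Φ Λ β)

/-- The Gibbs covariance `Cov_{Λ,β}(f, g)`. -/
def gibbsCov [Fintype S] (Φ : Potential d S) (Λ : Finset (Site d)) (β : ℝ)
    (f g : Config S Λ → ℝ) : ℝ :=
  gibbsExpectation Φ Λ β (fun ω => f ω * g ω) -
    gibbsExpectation Φ Λ β f * gibbsExpectation Φ Λ β g

/-- The potential is positively correlated: `Cov_{Λ,β}(Φ_A, Φ_B) ≥ 0` for all finite `Λ`, all
non-empty `A, B ⊆ Λ` and all `β > 0`. -/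
def PositivelyCorrelated [Fintype S] (Φ : Potential d S) : Prop :=
  ∀ (Λ A B : Finset (Site d)), A ⊆ Λ → B ⊆ Λ → A.Nonempty → B.Nonempty → ∀ β : ℝ, 0 < β →
    0 ≤ gibbsCov Φ Λ β (extend Φ Λ A) (extend Φ Λ B)

/-- The hypercube `Λ_n = [-n, n]^d ∩ ℤ^d`. -/
def box (d n : ℕ) : Finset (Site d) := Fintype.piFinset fun _ => Finset.Icc (-(n : ℤ)) n

/-- The finite-volume pressure `-(1/|Λ_n|) log Z_{Λ_n,β}`. -/
def finitePressure [Fintype S] (Φ : Potential d S) (n : ℕ) (β : ℝ) : ℝ :=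
  -(1 / ((box d n).card : ℝ)) * Real.log (partitionFunction Φ (box d n) β)

/-- The pressure `ψ(β) = lim_n -(1/|Λ_n|) log Z_{Λ_n,β}`. -/
def pressure [Fintype S] (Φ : Potential d S) (β : ℝ) : ℝ :=
  limUnder atTop fun n => finitePressure Φ n β

/-- `(1/|Λ_n|) log 𝕄_n(B)`, in the extended reals with `log 0 = -∞`, where
`𝕄_n(B) = ρ_n {ω ∈ Ω_{Λ_n} : H_{Λ_n}(ω) / |Λ_n| ∈ B}` and `ρ_n` is the counting measure. -/
def logEnergyMeasure (Φ : Potential d S) (n : ℕ) (B : Set ℝ) : EReal :=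
  ENNReal.log ({ω : Config S (box d n) |
    hamiltonian Φ (box d n) ω / ((box d n).card : ℝ) ∈ B}.encard : ENNReal) /
      (((box d n).card : ℝ) : EReal)

/-- `m(B) = lim_n (1/|Λ_n|) log 𝕄_n(B)`. -/
def energyRate (Φ : Potential d S) (B : Set ℝ) : EReal :=
  limUnder atTop fun n => logEnergyMeasure Φ n B

/-- The microcanonical entropy `s(u) = lim_{r → 0+} m((u - r, u + r))`. -/
def entropy (Φ : Potential d S) (u : ℝ) : EReal :=
  limUnder (𝓝[>] (0 : ℝ)) fun r => energyRate Φ (Ioo (u - r) (u + r))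

/-- The Euler characteristic `∑ (-1)^i dim H_i(X; ℚ)` of a topological space, computed from
singular homology (for a finite CW complex it is the alternating sum of the numbers of cells). -/
def eulerChar (X : Type u) [TopologicalSpace X] : ℤ :=
  (((AlgebraicTopology.singularChainComplexFunctor (ModuleCat.{u} ℚ)).obj
    (ModuleCat.of ℚ (ULift.{u} ℚ))).obj (TopCat.of X)).homologyEulerChar

/-- The sublevel set `M_Λ(u) = {ω ∈ Ω_Λ : H_Λ(ω) ≤ |Λ| u}`, a subspace of `Ω_Λ`. -/
def sublevel (Φ : Potential d S) (Λ : Finset (Site d)) (u : ℝ) : Set (Config S Λ) :=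
  {ω | hamiltonian Φ Λ ω ≤ (Λ.card : ℝ) * u}

/-- `(1/|Λ_n|) log |χ(M_{Λ_n}(u))|`, in the extended reals with `log 0 = -∞`. -/
def logEuler [TopologicalSpace S] (Φ : Potential d S) (n : ℕ) (u : ℝ) : EReal :=
  ENNReal.log ((eulerChar ↥(sublevel Φ (box d n) u)).natAbs : ENNReal) /
    (((box d n).card : ℝ) : EReal)

/-- The logarithmic density of the Euler characteristic
`σ(u) = lim_n (1/|Λ_n|) log |χ(M_{Λ_n}(u))|`. -/
def eulerDensity [TopologicalSpace S] (Φ : Potential d S) (u : ℝ) : EReal :=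
  limUnder atTop fun n => logEuler Φ n u

/-- `f : ℝ → ℝ` is `k` times differentiable at `x` (in the pointwise sense, no continuity of the
`k`-th derivative is asked): it is `k - 1` times differentiable near `x` and the `(k-1)`-st
derivative is differentiable at `x`. -/
def TimesDifferentiableAt : ℕ → (ℝ → ℝ) → ℝ → Prop
  | 0, _, _ => True
  | k + 1, f, x => (∀ᶠ y in 𝓝 x, TimesDifferentiableAt k f y) ∧
      DifferentiableAt ℝ (iteratedDeriv k f) x

/-- There is a phase transition of order `p ≥ 1` at inverse temperature `β > 0`: the pressure is
`p - 1` but not `p` times differentiable at `β`. -/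
def PhaseTransition [Fintype S] (Φ : Potential d S) (p : ℕ) (β : ℝ) : Prop :=
  0 < β ∧ 1 ≤ p ∧ TimesDifferentiableAt (p - 1) (pressure Φ) β ∧
    ¬ TimesDifferentiableAt p (pressure Φ) β

end LatticeSpin

end

noncomputable section

namespace LatticeSpin

universe u

/-! ### The Euler characteristic of a finite discrete space -/

/-! Since `S` is finite and discrete, so is every sublevel set. Its Euler characteristic is
therefore its number of points, and `σ` is a growth rate of cardinalities, just like `s`. It remains
to count configurations and to understand the pressure.

The pressure exists by a Fekete argument: `log Z` is superadditive after adding `β` times the total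
interaction norm, and that norm is itself superadditive. The decisive input is strong concavity. The
second derivative of the finite-volume pressure is minus the energy variance per site. Positive
correlation allows all covariances to be discarded except the variances of the translates of one
non-constant `Φ_A`, and finite energy bounds these below uniformly (`sq_sub_le_mul_gibbsCov`). So `ψ
+ c β²` is concave on each `(0, B)` for some `c > 0` (`exists_concaveOn_pressure_add`).

Without first order transitions `ψ` is differentiable, so `ψ'` is a strictly decreasing
homeomorphism of `(0, ∞)` onto a bounded interval `(a, b)`, and the Legendre transform `s` of `ψ`
has derivative `h = (ψ')⁻¹`. For the count, a Chernoff bound from above and exponential tilting from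
below show that sets lying below energy density `v` and containing a window ending at `v` grow at
rate `inf_β (β v - ψ β)` (`tendsto_log_card_div`). This covers energy windows and sublevel sets at
once, whence `σ = s`.

Finally `ψ''`, where it exists, is never zero, whereas `s''` may vanish, which happens where `ψ'`
has infinite slope. The inverse function theorem then matches orders of differentiability of `ψ` at
`h u` with those of `s` at `u`, with `s'' u ≠ 0` as the only side condition. -/

lemma eulerChar_eq_card (X : Type u) [TopologicalSpace X] [DiscreteTopology X] [Finite X] :
    eulerChar X = Nat.card X := by
  classical
  have := Fintype.ofFinite X
  unfold eulerChar
  have htd : TotallyDisconnectedSpace (TopCat.of X) := inferInstanceAs (TotallyDisconnectedSpace X)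
  -- Only degree zero contributes: a totally disconnected space has no singular homology in positive
  -- degrees, and `H_0` is a sum of copies of `ℚ` indexed by the points.
  rw [HomologicalComplex.homologyEulerChar_eq_sum_finSet_of_finrankSupport_subset _ {0}]
  · rw [Finset.sum_singleton]
    let e := AlgebraicTopology.singularHomologyFunctorZeroOfTotallyDisconnectedSpace
      (ModuleCat.{u} ℚ) (ModuleCat.of ℚ (ULift.{u} ℚ)) (TopCat.of X)
    let e' := ModuleCat.coprodIsoDirectSum (fun _ : X => ModuleCat.of ℚ (ULift.{u} ℚ))
    have h1 := (e.toLinearEquiv ≪≫ₗ e'.toLinearEquiv).finrank_eq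
    have h2 : Module.finrank ℚ (DirectSum X fun _ => ULift.{u} ℚ) = Nat.card X := by
      rw [Module.finrank_directSum]
      simp [Nat.card_eq_fintype_card]
    have h3 := h1.trans h2
    simp only [ComplexShape.eulerCharSignsDownNat_χ, pow_zero, Units.val_one, one_mul]
    exact congrArg Nat.cast h3
  · rw [GradedObject.finrankSupport_subset_iff]
    intro i hi
    have hi' : i ≠ 0 := by simpa using hi
    have hz := AlgebraicTopology.isZero_singularHomologyFunctor_of_totallyDisconnectedSpace
      (ModuleCat.{u} ℚ) i (ModuleCat.of ℚ (ULift.{u} ℚ)) (TopCat.of X) hi'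
    exact @Module.finrank_zero_of_subsingleton _ _ _ _ _ _ (ModuleCat.subsingleton_of_isZero hz)

/-! ### Calculus of `k` times differentiable functions -/

namespace TimesDifferentiableAt

lemma one_iff {f : ℝ → ℝ} {x : ℝ} : TimesDifferentiableAt 1 f x ↔ DifferentiableAt ℝ f x := by
  simp [TimesDifferentiableAt]

/-- The definition peels off the last derivative. Peeling off the first one instead is what makes
the chain, product and inverse rules provable by induction on the order. -/
lemma succ_succ_iff {k : ℕ} {f : ℝ → ℝ} {x : ℝ} : TimesDifferentiableAt (k + 2) f x ↔
    (∀ᶠ y in 𝓝 x, DifferentiableAt ℝ f y) ∧ TimesDifferentiableAt (k + 1) (deriv f) x := by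
  induction k generalizing x with
  | zero => simp [TimesDifferentiableAt, iteratedDeriv_one]
  | succ k ih =>
    change ((∀ᶠ y in 𝓝 x, TimesDifferentiableAt (k + 2) f y) ∧
      DifferentiableAt ℝ (iteratedDeriv (k + 2) f) x) ↔ _ ∧
      ((∀ᶠ y in 𝓝 x, TimesDifferentiableAt (k + 1) (deriv f) y) ∧
        DifferentiableAt ℝ (iteratedDeriv (k + 1) (deriv f)) x)
    simp only [ih, eventually_and, eventually_eventually_nhds, iteratedDeriv_succ', and_assoc]

variable {k : ℕ} {f g : ℝ → ℝ} {x : ℝ}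

lemma of_succ (h : TimesDifferentiableAt (k + 1) f x) : TimesDifferentiableAt k f x :=
  h.1.self_of_nhds

lemma differentiableAt (h : TimesDifferentiableAt (k + 1) f x) : DifferentiableAt ℝ f x := by
  induction k with
  | zero => exact one_iff.1 h
  | succ k ih => exact ih h.of_succ

theorem congr {k : ℕ} {f g : ℝ → ℝ} {x : ℝ} 
    (h : TimesDifferentiableAt k f x) (hfg : f =ᶠ[𝓝 x] g) :
    TimesDifferentiableAt k g x := by
  match k with
  | 0 => trivial
  | 1 => exact one_iff.2 ((one_iff.1 h).congr_of_eventuallyEq hfg.symm)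
  | k + 2 =>
    rw [succ_succ_iff] at h ⊢
    refine ⟨?_, congr h.2 hfg.deriv⟩
    filter_upwards [h.1, eventually_eventually_nhds.2 hfg] with y hy hy'
    exact hy.congr_of_eventuallyEq (EventuallyEq.symm hy')
termination_by k

lemma congr_iff (hfg : f =ᶠ[𝓝 x] g) :
    TimesDifferentiableAt k f x ↔ TimesDifferentiableAt k g x :=
  ⟨fun h => h.congr hfg, fun h => h.congr hfg.symm⟩

theorem add {k : ℕ} {f g : ℝ → ℝ} {x : ℝ} 
    (hf : TimesDifferentiableAt k f x) (hg : TimesDifferentiableAt k g x) :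
    TimesDifferentiableAt k (fun y => f y + g y) x := by
  match k with
  | 0 => trivial
  | 1 => exact one_iff.2 ((one_iff.1 hf).add (one_iff.1 hg))
  | k + 2 =>
    rw [succ_succ_iff] at hf hg ⊢
    refine ⟨?_, (add hf.2 hg.2).congr ?_⟩
    · filter_upwards [hf.1, hg.1] with y h1 h2 using h1.add h2
    · filter_upwards [hf.1, hg.1] with y h1 h2 using (deriv_fun_add h1 h2).symm
termination_by k

theorem mul {k : ℕ} {f g : ℝ → ℝ} {x : ℝ} 
    (hf : TimesDifferentiableAt k f x) (hg : TimesDifferentiableAt k g x) :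
    TimesDifferentiableAt k (fun y => f y * g y) x := by
  match k with
  | 0 => trivial
  | 1 => exact one_iff.2 ((one_iff.1 hf).mul (one_iff.1 hg))
  | k + 2 =>
    have hf1 := hf.of_succ
    have hg1 := hg.of_succ
    rw [succ_succ_iff] at hf hg ⊢
    refine ⟨?_, ((mul hf.2 hg1).add (mul hf1 hg.2)).congr ?_⟩
    · filter_upwards [hf.1, hg.1] with y h1 h2 using h1.mul h2
    · filter_upwards [hf.1, hg.1] with y h1 h2 using (deriv_fun_mul h1 h2).symm
termination_by k

theorem comp {k : ℕ} {f g : ℝ → ℝ} {x : ℝ} 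
    (hf : TimesDifferentiableAt k f (g x)) (hg : TimesDifferentiableAt k g x) :
    TimesDifferentiableAt k (fun y => f (g y)) x := by
  match k with
  | 0 => trivial
  | 1 => exact one_iff.2 ((one_iff.1 hf).comp x (one_iff.1 hg))
  | k + 2 =>
    have hg1 := hg.of_succ
    have hc : ContinuousAt g x := hg1.differentiableAt.continuousAt
    rw [succ_succ_iff] at hf hg ⊢
    refine ⟨?_, ((comp hf.2 hg1).mul hg.2).congr ?_⟩
    · filter_upwards [hc.eventually hf.1, hg.1] with y h1 h2 using h1.comp y h2
    · filter_upwards [hc.eventually hf.1, hg.1] with y h1 h2 using (deriv_comp y h1 h2).symm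
termination_by k

end TimesDifferentiableAt

theorem _root_.AnalyticAt.timesDifferentiableAt {f : ℝ → ℝ} {x : ℝ} (h : AnalyticAt ℝ f x)
    (k : ℕ) : TimesDifferentiableAt k f x := by
  match k with
  | 0 => trivial
  | 1 => exact TimesDifferentiableAt.one_iff.2 h.differentiableAt
  | k + 2 =>
    refine TimesDifferentiableAt.succ_succ_iff.2
      ⟨?_, AnalyticAt.timesDifferentiableAt h.deriv (k + 1)⟩
    filter_upwards [h.eventually_analyticAt] with y hy using hy.differentiableAt
termination_by k

namespace TimesDifferentiableAt

/-- The inverse function theorem for `k` times differentiable functions. -/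
theorem of_local_left_inverse {k : ℕ} {g h : ℝ → ℝ} {u : ℝ}
    (hg : TimesDifferentiableAt (k + 1) g (h u)) (hg' : deriv g (h u) ≠ 0)
    (hc : ∀ᶠ y in 𝓝 u, ContinuousAt h y) (hgh : ∀ᶠ y in 𝓝 u, g (h y) = y) :
    TimesDifferentiableAt (k + 1) h u := by
  induction k with
  | zero =>
    exact one_iff.2 (HasDerivAt.of_local_left_inverse hc.self_of_nhds
      (one_iff.1 hg).hasDerivAt hg' hgh).differentiableAt
  | succ k ih =>
    have hh := ih hg.of_succ
    rw [succ_succ_iff] at hg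
    have hne : ∀ᶠ z in 𝓝 (h u), deriv g z ≠ 0 :=
      hg.2.differentiableAt.continuousAt.eventually_ne hg'
    -- Bootstrapping: `h' = 1 / (g' ∘ h)` near `u`, so `h'` inherits the order of differentiability
    -- already known for `h`, and `h` gains one.
    have hd : ∀ᶠ y in 𝓝 u, HasDerivAt h (deriv g (h y))⁻¹ y := by
      filter_upwards [hc.self_of_nhds.eventually hne, hc.self_of_nhds.eventually hg.1, hc,
        hgh.eventually_nhds] with y h1 h2 h3 h4
      exact HasDerivAt.of_local_left_inverse h3 h2.hasDerivAt h1 h4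
    refine succ_succ_iff.2 ⟨hd.mono fun y hy => hy.differentiableAt, ?_⟩
    refine TimesDifferentiableAt.congr (f := fun y => (deriv g (h y))⁻¹) ?_
      (hd.mono fun y hy => hy.deriv.symm)
    exact comp (f := fun y : ℝ => y⁻¹) (g := fun y => deriv g (h y))
      ((analyticAt_inv hg').timesDifferentiableAt _) (comp hg.2 hh)

/-- The sides are asymmetric because `hne` excludes a zero derivative for `g` only; `h` may have
derivative zero, and then `g` is not differentiable at `b`. -/
theorem iff_of_local_inverse {k : ℕ} {g h : ℝ → ℝ} {u b : ℝ} (hu : h u = b) (hb : g b = u)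
    (hcg : ∀ᶠ x in 𝓝 b, ContinuousAt g x) (hch : ∀ᶠ y in 𝓝 u, ContinuousAt h y)
    (hgh : ∀ᶠ y in 𝓝 u, g (h y) = y) (hhg : ∀ᶠ x in 𝓝 b, h (g x) = x)
    (hne : DifferentiableAt ℝ g b → deriv g b ≠ 0) :
    TimesDifferentiableAt (k + 1) g b ↔ TimesDifferentiableAt (k + 1) h u ∧ deriv h u ≠ 0 := by
  subst hu
  constructor
  · intro hg
    have hg' := hne hg.differentiableAt
    refine ⟨of_local_left_inverse hg hg' hch hgh, ?_⟩
    rw [(HasDerivAt.of_local_left_inverse hch.self_of_nhds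
      hg.differentiableAt.hasDerivAt hg' hgh).deriv]
    exact inv_ne_zero hg'
  · rintro ⟨h1, h2⟩
    refine of_local_left_inverse (g := h) ?_ ?_ hcg hhg <;> rwa [hb]

end TimesDifferentiableAt

/-! ### Legendre duality for differentiable, locally strongly concave functions -/

section Legendre

variable {ψ : ℝ → ℝ}

/-- The derivative `ψ' + 2 c x` of the concave function `ψ + c x²` is antitone, which explains the
constant `2 * c`. -/
lemma exists_pos_mul_sub_le_deriv_sub (hψ : ∀ x, 0 < x → DifferentiableAt ℝ ψ x)
    (hc : ∀ B, 0 < B → ∃ c > 0, ConcaveOn ℝ (Ioo 0 B) fun x => ψ x + c * x ^ 2)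
    {B : ℝ} (hB : 0 < B) :
    ∃ c > 0, ∀ x y, 0 < x → x ≤ y → y < B → c * (y - x) ≤ deriv ψ x - deriv ψ y := by
  obtain ⟨c, hc0, hcB⟩ := hc B hB
  refine ⟨2 * c, by positivity, fun x y hx hxy hy => ?_⟩
  have hder : ∀ z, 0 < z → HasDerivAt (fun x => ψ x + c * x ^ 2) (deriv ψ z + c * (2 * z)) z := by
    intro z hz
    simpa using (hψ z hz).hasDerivAt.fun_add (((hasDerivAt_id z).fun_pow 2).const_mul c)
  have := hcB.antitoneOn_deriv (fun z hz => (hder z hz.1).differentiableAt)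
    (⟨hx, hxy.trans_lt hy⟩ : x ∈ Ioo 0 B) (⟨hx.trans_le hxy, hy⟩ : y ∈ Ioo 0 B) hxy
  rw [(hder x hx).deriv, (hder y (hx.trans_le hxy)).deriv] at this
  linarith

lemma strictAntiOn_deriv_of_stronglyConcave (hψ : ∀ x, 0 < x → DifferentiableAt ℝ ψ x)
    (hc : ∀ B, 0 < B → ∃ c > 0, ConcaveOn ℝ (Ioo 0 B) fun x => ψ x + c * x ^ 2) :
    StrictAntiOn (deriv ψ) (Ioi 0) := by
  intro x hx y hy hxy
  obtain ⟨c, hc0, h⟩ := exists_pos_mul_sub_le_deriv_sub hψ hc (B := y + 1)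
    (by have := mem_Ioi.1 hy; linarith)
  have h1 := h x y hx hxy.le (by linarith)
  have h2 : 0 < c * (y - x) := mul_pos hc0 (sub_pos.2 hxy)
  linarith

lemma le_tangent_of_stronglyConcave (hψ : ∀ x, 0 < x → DifferentiableAt ℝ ψ x)
    (hc : ∀ B, 0 < B → ∃ c > 0, ConcaveOn ℝ (Ioo 0 B) fun x => ψ x + c * x ^ 2)
    {x y : ℝ} (hx : 0 < x) (hy : 0 < y) : ψ y ≤ ψ x + deriv ψ x * (y - x) := by
  have hconc : ConcaveOn ℝ (Ioi 0) ψ := by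
    refine AntitoneOn.concaveOn_of_deriv (convex_Ioi 0)
      (fun z hz => (hψ z hz).continuousAt.continuousWithinAt) ?_ ?_ <;> rw [interior_Ioi]
    · exact fun z hz => (hψ z hz).differentiableWithinAt
    · exact (strictAntiOn_deriv_of_stronglyConcave hψ hc).antitoneOn
  rcases lt_trichotomy x y with h | rfl | h
  · have := hconc.slope_le_of_hasDerivAt (mem_Ioi.2 hx) (mem_Ioi.2 hy) h (hψ x hx).hasDerivAt
    rw [slope_def_field, div_le_iff₀ (sub_pos.2 h)] at this
    linarith
  · simp
  · have := hconc.le_slope_of_hasDerivAt (mem_Ioi.2 hy) (mem_Ioi.2 hx) h (hψ x hx).hasDerivAt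
    rw [slope_def_field, le_div_iff₀ (sub_pos.2 h)] at this
    linarith

/-- The quantitative decrease of `ψ'` forces `ψ'' ≤ -c`. This is the nonvanishing needed to invert
`ψ'` without losing differentiability. -/
lemma deriv_deriv_ne_zero_of_stronglyConcave (hψ : ∀ x, 0 < x → DifferentiableAt ℝ ψ x)
    (hc : ∀ B, 0 < B → ∃ c > 0, ConcaveOn ℝ (Ioo 0 B) fun x => ψ x + c * x ^ 2)
    {x : ℝ} (hx : 0 < x) (hd : DifferentiableAt ℝ (deriv ψ) x) : deriv (deriv ψ) x ≠ 0 := by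
  obtain ⟨c, hc0, h⟩ := exists_pos_mul_sub_le_deriv_sub hψ hc (B := x + 1) (by linarith)
  have hanti : AntitoneOn (fun y => deriv ψ y + c * y) (Ioo 0 (x + 1)) := by
    intro y hy z hz hyz
    have := h y z hy.1 hyz hz.2
    simp only
    linarith
  have h1 := hanti.derivWithin_nonpos (x := x)
  have h2 : HasDerivAt (fun y => deriv ψ y + c * y) (deriv (deriv ψ) x + c) x := by
    simpa using hd.hasDerivAt.fun_add ((hasDerivAt_id x).const_mul c)
  rw [derivWithin_of_isOpen isOpen_Ioo ⟨hx, by linarith⟩, h2.deriv] at h1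
  linarith

/-- The derivative of a strongly concave function is a homeomorphism onto an open interval. -/
theorem exists_inverse_deriv_of_stronglyConcave (hψ : ∀ x, 0 < x → DifferentiableAt ℝ ψ x)
    (hc : ∀ B, 0 < B → ∃ c > 0, ConcaveOn ℝ (Ioo 0 B) fun x => ψ x + c * x ^ 2)
    (hb : ∃ C, ∀ x, 0 < x → |deriv ψ x| ≤ C) :
    ∃ (a b : ℝ) (h : ℝ → ℝ), a < b ∧ MapsTo (deriv ψ) (Ioi 0) (Ioo a b) ∧
      MapsTo h (Ioo a b) (Ioi 0) ∧ InvOn h (deriv ψ) (Ioi 0) (Ioo a b) ∧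
      (∀ x, 0 < x → ContinuousAt (deriv ψ) x) ∧ (∀ u ∈ Ioo a b, ContinuousAt h u) := by
  have hanti := strictAntiOn_deriv_of_stronglyConcave hψ hc
  obtain ⟨C, hC⟩ := hb
  set I := deriv ψ '' Ioi 0 with hI
  -- Darboux: the image of a derivative is an interval, although continuity of `ψ'` is not yet
  -- known.
  have hord : I.OrdConnected := (ordConnected_Ioi).image_deriv fun x hx => hψ x hx
  have hba : BddAbove I := ⟨C, by rintro _ ⟨x, hx, rfl⟩; exact (abs_le.1 (hC x hx)).2⟩
  have hbb : BddBelow I := ⟨-C, by rintro _ ⟨x, hx, rfl⟩; exact (abs_le.1 (hC x hx)).1⟩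
  have hne : I.Nonempty := ⟨_, 1, by simp, rfl⟩
  have hmaps : MapsTo (deriv ψ) (Ioi 0) (Ioo (sInf I) (sSup I)) := by
    intro x hx
    have hx0 : (0 : ℝ) < x := hx
    constructor
    · exact (csInf_le hbb (mem_image_of_mem _ (show x + 1 ∈ Ioi (0 : ℝ) by
        simp only [mem_Ioi]; linarith))).trans_lt
        (hanti hx (by simp only [mem_Ioi]; linarith) (by linarith))
    · exact (hanti (show x / 2 ∈ Ioi (0 : ℝ) by simp only [mem_Ioi]; linarith) hx
        (by linarith)).trans_le (le_csSup hba (mem_image_of_mem _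
          (by simp only [mem_Ioi]; linarith)))
  have hsurj : ∀ u ∈ Ioo (sInf I) (sSup I), u ∈ I := by
    intro u hu
    obtain ⟨y, hy, hyu⟩ := exists_lt_of_csInf_lt hne hu.1
    obtain ⟨z, hz, huz⟩ := exists_lt_of_lt_csSup hne hu.2
    exact hord.out hy hz ⟨hyu.le, huz.le⟩
  choose! h hh0 hh using hsurj
  have hinv : InvOn h (deriv ψ) (Ioi 0) (Ioo (sInf I) (sSup I)) :=
    ⟨fun x hx => hanti.injOn (hh0 _ (hmaps hx)) hx (hh _ (hmaps hx)), fun u hu => hh u hu⟩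
  refine ⟨sInf I, sSup I, h, ?_, hmaps, hh0, hinv, fun x hx => ?_, fun u hu => ?_⟩
  · have := hmaps (show (1 : ℝ) ∈ Ioi 0 by simp)
    exact this.1.trans this.2
  -- A strictly monotone function whose image is a neighbourhood of its value is continuous there;
  -- the sign change turns decreasing into increasing. The same argument serves for `h` below.
  · have h1 : StrictMonoOn (fun x => -deriv ψ x) (Ioi 0) := hanti.neg
    have h2 := h1.continuousAt_of_image_mem_nhds (Ioi_mem_nhds hx)
      (mem_of_superset (Ioo_mem_nhds (neg_lt_neg (hmaps hx).2) (neg_lt_neg (hmaps hx).1)) ?_)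
    · simpa only [Pi.neg_def, neg_neg] using h2.neg
    · intro v hv
      have hv' : -v ∈ Ioo (sInf I) (sSup I) := ⟨by linarith [hv.2], by linarith [hv.1]⟩
      exact ⟨h (-v), hh0 _ hv', by simp [hh _ hv']⟩
  · have h1 : StrictMonoOn (fun u => -h u) (Ioo (sInf I) (sSup I)) := by
      intro v hv w hw hvw
      rw [neg_lt_neg_iff]
      by_contra hcon
      have := hanti.antitoneOn (hh0 v hv) (hh0 w hw) (not_lt.1 hcon)
      rw [hh v hv, hh w hw] at this
      linarith
    have h2 := h1.continuousAt_of_image_mem_nhds (Ioo_mem_nhds hu.1 hu.2)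
      (mem_of_superset (Iio_mem_nhds (neg_lt_zero.2 (hh0 u hu))) ?_)
    · simpa only [Pi.neg_def, neg_neg] using h2.neg
    · intro v hv
      have hv' : -v ∈ Ioi (0 : ℝ) := by simpa using hv
      exact ⟨deriv ψ (-v), hmaps hv', by simp [hinv.1 hv']⟩

/-- The Legendre transform is differentiable, with the inverse of `ψ'` as its derivative. -/
theorem hasDerivAt_legendre (hψ : ∀ x, 0 < x → DifferentiableAt ℝ ψ x)
    (hc : ∀ B, 0 < B → ∃ c > 0, ConcaveOn ℝ (Ioo 0 B) fun x => ψ x + c * x ^ 2)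
    {a b u : ℝ} {h : ℝ → ℝ} (hh : MapsTo h (Ioo a b) (Ioi 0))
    (hinv : ∀ v ∈ Ioo a b, deriv ψ (h v) = v) (hu : u ∈ Ioo a b) (hcont : ContinuousAt h u) :
    HasDerivAt (fun v => h v * v - ψ (h v)) (h u) u := by
  rw [hasDerivAt_iff_isLittleO]
  have h1 : (fun v => h v - h u) =o[𝓝 u] fun _ => (1 : ℝ) := by
    rw [Asymptotics.isLittleO_one_iff]
    simpa using hcont.sub_const (h u)
  have h2 := h1.mul_isBigO (Asymptotics.isBigO_refl (fun v => v - u) (𝓝 u))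
  simp only [one_mul] at h2
  refine Asymptotics.IsBigO.trans_isLittleO (Asymptotics.IsBigO.of_bound 1 ?_) h2
  filter_upwards [Ioo_mem_nhds hu.1 hu.2] with v hv
  -- The tangent inequalities at `h v` and `h u` trap the remainder between `(h v - h u) * (v - u)`
  -- and `0`, and continuity of `h` makes the former `o(v - u)`.
  have t1 := le_tangent_of_stronglyConcave hψ hc (hh hv) (hh hu)
  have t2 := le_tangent_of_stronglyConcave hψ hc (hh hu) (hh hv)
  rw [hinv v hv] at t1
  rw [hinv u hu] at t2
  rw [one_mul, Real.norm_eq_abs, Real.norm_eq_abs, smul_eq_mul]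
  have e1 : h v * v - ψ (h v) - (h u * u - ψ (h u)) - (v - u) * h u ≤ 0 := by linarith
  have e2 : (h v - h u) * (v - u) ≤
      h v * v - ψ (h v) - (h u * u - ψ (h u)) - (v - u) * h u := by linarith
  exact abs_le_abs_of_nonpos e1 e2

end Legendre

variable {d : ℕ} {S : Type u}

/-! ### Norm bounds for the interaction -/

lemma supNorm_nonneg (Φ : Potential d S) (A : Finset (Site d)) : 0 ≤ supNorm Φ A :=
  Real.iSup_nonneg fun _ => abs_nonneg _

lemma abs_le_supNorm [Finite S] (Φ : Potential d S) (A : Finset (Site d)) (ω : Config S A) :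
    |Φ A ω| ≤ supNorm Φ A :=
  le_ciSup (f := fun ω : Config S A => |Φ A ω|) (Set.finite_range _).bddAbove ω

lemma extend_of_subset (Φ : Potential d S) {Λ A : Finset (Site d)} (h : A ⊆ Λ)
    (ω : Config S Λ) : extend Φ Λ A ω = Φ A (Finset.restrict₂ (π := fun _ => S) h ω) :=
  dif_pos h

lemma abs_extend_le [Finite S] (Φ : Potential d S) (Λ A : Finset (Site d)) (ω : Config S Λ) :
    |extend Φ Λ A ω| ≤ supNorm Φ A := by
  by_cases h : A ⊆ Λ
  · rw [extend_of_subset Φ h]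
    exact abs_le_supNorm Φ A _
  · simp [extend, h, supNorm_nonneg]

lemma extend_restrict (Φ : Potential d S) {Λ Λ' A : Finset (Site d)} (hA : A ⊆ Λ) (h : Λ ⊆ Λ')
    (ω : Config S Λ') :
    extend Φ Λ A (Finset.restrict₂ (π := fun _ => S) h ω) = extend Φ Λ' A ω := by
  rw [extend_of_subset Φ hA, extend_of_subset Φ (hA.trans h)]
  rfl

lemma mem_translate {x y : Site d} {A : Finset (Site d)} : y ∈ translate x A ↔ y - x ∈ A := by
  simp only [translate, Finset.mem_map, addRightEmbedding_apply]
  exact ⟨by rintro ⟨z, hz, rfl⟩; simpa using hz, fun h => ⟨_, h, by simp⟩⟩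

lemma translate_nonempty {x : Site d} {A : Finset (Site d)} :
    (translate x A).Nonempty ↔ A.Nonempty := Finset.map_nonempty

lemma translate_injective (x : Site d) : Function.Injective (translate x) :=
  Finset.map_injective _

lemma translate_translate_neg (x : Site d) (A : Finset (Site d)) :
    translate x (translate (-x) A) = A := by
  ext y
  simp [mem_translate]

lemma translate_subset_translate {x : Site d} {A B : Finset (Site d)} :
    translate x A ⊆ translate x B ↔ A ⊆ B := Finset.map_subset_map

lemma card_translate (x : Site d) (A : Finset (Site d)) : (translate x A).card = A.card :=
  Finset.card_map _

lemma pullback_bijective (x : Site d) (A : Finset (Site d)) :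
    Function.Bijective (pullback (S := S) x A) := by
  constructor
  · intro ω ω' h
    funext z
    have hz := mem_translate.1 z.2
    have := congrFun h ⟨_, hz⟩
    simpa [pullback] using this
  · intro ω
    refine ⟨fun z => ω ⟨_, mem_translate.1 z.2⟩, ?_⟩
    funext y
    simp [pullback]

lemma supNorm_translate {Φ : Potential d S} (hinv : TranslationInvariant Φ) (x : Site d)
    {A : Finset (Site d)} (hA : A.Nonempty) : supNorm Φ (translate x A) = supNorm Φ A :=
  (pullback_bijective x A).surjective.iSup_congr _ fun ω => by rw [hinv x A hA ω]

/-- The total interaction strength `∑_{A ∋ 0} ‖Φ_A‖` felt by a site. -/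
def siteNorm (Φ : Potential d S) : ℝ :=
  ∑' A : {A : Finset (Site d) // (0 : Site d) ∈ A}, supNorm Φ A.1

lemma siteNorm_nonneg (Φ : Potential d S) : 0 ≤ siteNorm Φ :=
  tsum_nonneg fun _ => supNorm_nonneg Φ _

lemma sum_supNorm_le_siteNorm {Φ : Potential d S} (hinv : TranslationInvariant Φ)
    (hsum : AbsolutelySummable Φ) (x : Site d) (F : Finset (Finset (Site d)))
    (hF : ∀ A ∈ F, x ∈ A) : ∑ A ∈ F, supNorm Φ A ≤ siteNorm Φ := by
  have hmem : ∀ A : F, (0 : Site d) ∈ translate (-x) A.1 := fun A => by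
    simpa [mem_translate] using hF A.1 A.2
  let e : F ↪ {A : Finset (Site d) // (0 : Site d) ∈ A} :=
    ⟨fun A => ⟨translate (-x) A.1, hmem A⟩, fun A B h =>
      Subtype.ext (translate_injective (-x) (congrArg Subtype.val h))⟩
  have h1 : ∑ A ∈ F, supNorm Φ A = ∑ A ∈ F.attach.map e, supNorm Φ A.1 := by
    rw [Finset.sum_map, ← Finset.sum_attach]
    refine Finset.sum_congr rfl fun A _ => ?_
    exact (supNorm_translate hinv (-x) ⟨x, hF A.1 A.2⟩).symm
  rw [h1]
  exact hsum.sum_le_tsum _ fun _ _ => supNorm_nonneg Φ _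

/-- Each `A` is charged to every site of `Λ` that it contains, and each site carries at most
`siteNorm Φ`. -/
lemma sum_supNorm_le_card_mul {Φ : Potential d S} (hinv : TranslationInvariant Φ)
    (hsum : AbsolutelySummable Φ) (Λ : Finset (Site d)) (F : Finset (Finset (Site d)))
    (hF : ∀ A ∈ F, ∃ x ∈ Λ, x ∈ A) : ∑ A ∈ F, supNorm Φ A ≤ siteNorm Φ * Λ.card := by
  calc ∑ A ∈ F, supNorm Φ A ≤ ∑ A ∈ F, ∑ x ∈ Λ, if x ∈ A then supNorm Φ A else 0 := by
        refine Finset.sum_le_sum fun A hA => ?_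
        obtain ⟨x, hx, hxA⟩ := hF A hA
        refine le_trans (by simp [hxA]) (Finset.single_le_sum
          (f := fun x => if x ∈ A then supNorm Φ A else 0) (fun y _ => ?_) hx)
        split_ifs <;> simp [supNorm_nonneg]
    _ = ∑ x ∈ Λ, ∑ A ∈ F with x ∈ A, supNorm Φ A := by
        rw [Finset.sum_comm]
        simp only [Finset.sum_filter]
    _ ≤ ∑ x ∈ Λ, siteNorm Φ := Finset.sum_le_sum fun x _ =>
        sum_supNorm_le_siteNorm hinv hsum x _ fun A hA => (Finset.mem_filter.1 hA).2
    _ = siteNorm Φ * Λ.card := by simp [mul_comm]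

/-- The sum of the norms of the interactions inside `Λ`. -/
def totalNorm (Φ : Potential d S) (Λ : Finset (Site d)) : ℝ :=
  ∑ A ∈ Λ.powerset with A.Nonempty, supNorm Φ A

lemma totalNorm_nonneg (Φ : Potential d S) (Λ : Finset (Site d)) : 0 ≤ totalNorm Φ Λ :=
  Finset.sum_nonneg fun _ _ => supNorm_nonneg Φ _

lemma totalNorm_le {Φ : Potential d S} (hinv : TranslationInvariant Φ)
    (hsum : AbsolutelySummable Φ) (Λ : Finset (Site d)) :
    totalNorm Φ Λ ≤ siteNorm Φ * Λ.card := by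
  refine sum_supNorm_le_card_mul hinv hsum Λ _ fun A hA => ?_
  simp only [Finset.mem_filter, Finset.mem_powerset] at hA
  obtain ⟨x, hx⟩ := hA.2
  exact ⟨x, hA.1 hx, hx⟩

lemma abs_hamiltonian_le [Finite S] (Φ : Potential d S) (Λ : Finset (Site d)) (ω : Config S Λ) :
    |hamiltonian Φ Λ ω| ≤ totalNorm Φ Λ :=
  (Finset.abs_sum_le_sum_abs _ _).trans (Finset.sum_le_sum fun A _ => abs_extend_le Φ Λ A ω)

lemma sum_powerset_translate {M : Type*} [AddCommMonoid M] (x : Site d) (Λ : Finset (Site d))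
    (f : Finset (Site d) → M) :
    ∑ A ∈ (translate x Λ).powerset with A.Nonempty, f A =
      ∑ A ∈ Λ.powerset with A.Nonempty, f (translate x A) := by
  symm
  refine Finset.sum_bij (fun A _ => translate x A) (fun A hA => ?_)
    (fun A _ B _ h => translate_injective x h) (fun B hB => ?_) fun _ _ => rfl
  · simp only [Finset.mem_filter, Finset.mem_powerset] at hA ⊢
    exact ⟨translate_subset_translate.2 hA.1, translate_nonempty.2 hA.2⟩
  · simp only [Finset.mem_filter, Finset.mem_powerset] at hB
    refine ⟨translate (-x) B, ?_, translate_translate_neg x B⟩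
    simp only [Finset.mem_filter, Finset.mem_powerset]
    refine ⟨?_, translate_nonempty.2 hB.2⟩
    rw [← translate_subset_translate (x := x), translate_translate_neg]
    exact hB.1

lemma totalNorm_translate {Φ : Potential d S} (hinv : TranslationInvariant Φ) (x : Site d)
    (Λ : Finset (Site d)) : totalNorm Φ (translate x Λ) = totalNorm Φ Λ := by
  rw [totalNorm, sum_powerset_translate]
  exact Finset.sum_congr rfl fun A hA => supNorm_translate hinv x (Finset.mem_filter.1 hA).2

lemma extend_translate {Φ : Potential d S} (hinv : TranslationInvariant Φ) (x : Site d)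
    {Λ A : Finset (Site d)} (hA : A.Nonempty) (h : A ⊆ Λ) (ω : Config S (translate x Λ)) :
    extend Φ (translate x Λ) (translate x A) ω = extend Φ Λ A (pullback x Λ ω) := by
  rw [extend_of_subset Φ h, extend_of_subset Φ (translate_subset_translate.2 h), hinv x A hA]
  rfl

lemma hamiltonian_translate {Φ : Potential d S} (hinv : TranslationInvariant Φ) (x : Site d)
    (Λ : Finset (Site d)) (ω : Config S (translate x Λ)) :
    hamiltonian Φ (translate x Λ) ω = hamiltonian Φ Λ (pullback x Λ ω) := by
  rw [hamiltonian, sum_powerset_translate]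
  refine Finset.sum_congr rfl fun A hA => ?_
  simp only [Finset.mem_filter, Finset.mem_powerset] at hA
  exact extend_translate hinv x hA.2 hA.1 ω

lemma partitionFunction_translate [Fintype S] {Φ : Potential d S}
    (hinv : TranslationInvariant Φ) (x : Site d) (Λ : Finset (Site d)) (β : ℝ) :
    partitionFunction Φ (translate x Λ) β = partitionFunction Φ Λ β :=
  Fintype.sum_bijective _ (pullback_bijective x Λ) _ _ fun ω => by
    rw [hamiltonian_translate hinv]

/-! ### Superadditivity -/

section Superadditive

variable {Λ₁ Λ₂ : Finset (Site d)}

lemma disjoint_nonempty_powerset (h : Disjoint Λ₁ Λ₂) :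
    Disjoint {A ∈ Λ₁.powerset | A.Nonempty} {A ∈ Λ₂.powerset | A.Nonempty} := by
  rw [Finset.disjoint_left]
  intro A h1 h2
  simp only [Finset.mem_filter, Finset.mem_powerset] at h1 h2
  obtain ⟨x, hx⟩ := h1.2
  exact Finset.disjoint_left.1 h (h1.1 hx) (h2.1 hx)

lemma nonempty_powerset_union_subset :
    {A ∈ Λ₁.powerset | A.Nonempty} ∪ {A ∈ Λ₂.powerset | A.Nonempty} ⊆
      {A ∈ (Λ₁ ∪ Λ₂).powerset | A.Nonempty} := by
  intro A hA
  simp only [Finset.mem_union, Finset.mem_filter, Finset.mem_powerset] at hA ⊢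
  rcases hA with hA | hA
  · exact ⟨hA.1.trans Finset.subset_union_left, hA.2⟩
  · exact ⟨hA.1.trans Finset.subset_union_right, hA.2⟩

lemma totalNorm_superadditive (Φ : Potential d S) (h : Disjoint Λ₁ Λ₂) :
    totalNorm Φ Λ₁ + totalNorm Φ Λ₂ ≤ totalNorm Φ (Λ₁ ∪ Λ₂) := by
  rw [totalNorm, totalNorm, ← Finset.sum_union (disjoint_nonempty_powerset h)]
  exact Finset.sum_le_sum_of_subset_of_nonneg nonempty_powerset_union_subset
    fun A _ _ => supNorm_nonneg Φ A

/-- Only interactions that straddle `Λ₁` and `Λ₂` are missing from the two separate energies, and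
the defect of `totalNorm` is exactly their total norm. -/
lemma hamiltonian_union_le [Finite S] (Φ : Potential d S) (h : Disjoint Λ₁ Λ₂)
    (ω : Config S (Λ₁ ∪ Λ₂)) :
    hamiltonian Φ (Λ₁ ∪ Λ₂) ω ≤
      hamiltonian Φ Λ₁ (Finset.restrict₂ (π := fun _ => S) Finset.subset_union_left ω) +
      hamiltonian Φ Λ₂ (Finset.restrict₂ (π := fun _ => S) Finset.subset_union_right ω) +
      (totalNorm Φ (Λ₁ ∪ Λ₂) - totalNorm Φ Λ₁ - totalNorm Φ Λ₂) := by
  have h1 : hamiltonian Φ Λ₁ (Finset.restrict₂ (π := fun _ => S) Finset.subset_union_left ω) =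
      ∑ A ∈ Λ₁.powerset with A.Nonempty, extend Φ (Λ₁ ∪ Λ₂) A ω :=
    Finset.sum_congr rfl fun A hA =>
      extend_restrict Φ (Finset.mem_powerset.1 (Finset.mem_filter.1 hA).1) _ ω
  have h2 : hamiltonian Φ Λ₂ (Finset.restrict₂ (π := fun _ => S) Finset.subset_union_right ω) =
      ∑ A ∈ Λ₂.powerset with A.Nonempty, extend Φ (Λ₁ ∪ Λ₂) A ω :=
    Finset.sum_congr rfl fun A hA =>
      extend_restrict Φ (Finset.mem_powerset.1 (Finset.mem_filter.1 hA).1) _ ω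
  have h3 : hamiltonian Φ (Λ₁ ∪ Λ₂) ω =
      ∑ A ∈ (Λ₁ ∪ Λ₂).powerset with A.Nonempty, extend Φ (Λ₁ ∪ Λ₂) A ω := rfl
  have hU := disjoint_nonempty_powerset h
  rw [h1, h2, h3, ← Finset.sum_union hU, ← Finset.sum_sdiff nonempty_powerset_union_subset,
    sub_sub, totalNorm, totalNorm, totalNorm, ← Finset.sum_union hU,
    ← Finset.sum_sdiff nonempty_powerset_union_subset, add_sub_cancel_right, add_comm]
  exact (add_le_add_iff_left _).2
    (Finset.sum_le_sum fun A _ => (le_abs_self _).trans (abs_extend_le Φ _ A ω))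

lemma restrict_union_bijective (h : Disjoint Λ₁ Λ₂) :
    Function.Bijective fun ω : Config S (Λ₁ ∪ Λ₂) =>
      ((Finset.restrict₂ (π := fun _ => S) Finset.subset_union_left ω : Config S Λ₁),
        (Finset.restrict₂ (π := fun _ => S) Finset.subset_union_right ω : Config S Λ₂)) := by
  constructor
  · intro ω ω' heq
    rw [Prod.mk.injEq] at heq
    funext z
    rcases Finset.mem_union.1 z.2 with hz | hz
    · exact congrFun heq.1 ⟨z.1, hz⟩
    · exact congrFun heq.2 ⟨z.1, hz⟩
  · rintro ⟨ω₁, ω₂⟩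
    refine ⟨fun z => if hz : z.1 ∈ Λ₁ then ω₁ ⟨z.1, hz⟩ else
      ω₂ ⟨z.1, (Finset.mem_union.1 z.2).resolve_left hz⟩, Prod.ext ?_ ?_⟩
    · funext z
      simp [Finset.restrict₂]
    · funext z
      have : z.1 ∉ Λ₁ := fun hz => Finset.disjoint_left.1 h hz z.2
      simp [Finset.restrict₂, this]

variable [Fintype S]

lemma partitionFunction_pos [Nonempty S] (Φ : Potential d S) (Λ : Finset (Site d)) (β : ℝ) :
    0 < partitionFunction Φ Λ β :=
  Finset.sum_pos (fun _ _ => Real.exp_pos _) Finset.univ_nonempty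

lemma partitionFunction_mul_le (Φ : Potential d S) (h : Disjoint Λ₁ Λ₂) {β : ℝ} (hβ : 0 ≤ β) :
    partitionFunction Φ Λ₁ β * partitionFunction Φ Λ₂ β *
      Real.exp (-β * (totalNorm Φ (Λ₁ ∪ Λ₂) - totalNorm Φ Λ₁ - totalNorm Φ Λ₂)) ≤
      partitionFunction Φ (Λ₁ ∪ Λ₂) β := by
  rw [partitionFunction, partitionFunction, Finset.sum_mul_sum, ← Fintype.sum_prod_type',
    ← Fintype.sum_bijective _ (restrict_union_bijective (S := S) h) _ _ (fun ω => rfl),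
    Finset.sum_mul]
  refine Finset.sum_le_sum fun ω _ => ?_
  rw [← Real.exp_add, ← Real.exp_add]
  refine Real.exp_le_exp.2 ?_
  nlinarith [hamiltonian_union_le Φ h ω]

/-- The correction `β * totalNorm` absorbs the straddling interactions exactly, so no surface
estimate is required. -/
lemma log_partitionFunction_superadditive [Nonempty S] (Φ : Potential d S)
    (h : Disjoint Λ₁ Λ₂) {β : ℝ} (hβ : 0 ≤ β) :
    (Real.log (partitionFunction Φ Λ₁ β) + β * totalNorm Φ Λ₁) +
      (Real.log (partitionFunction Φ Λ₂ β) + β * totalNorm Φ Λ₂) ≤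
      Real.log (partitionFunction Φ (Λ₁ ∪ Λ₂) β) + β * totalNorm Φ (Λ₁ ∪ Λ₂) := by
  have h1 := partitionFunction_pos Φ Λ₁ β
  have h2 := partitionFunction_pos Φ Λ₂ β
  have := Real.log_le_log (by positivity) (partitionFunction_mul_le Φ h hβ)
  rw [Real.log_mul (by positivity) (by positivity), Real.log_mul (by positivity) (by positivity),
    Real.log_exp] at this
  linarith

/-- Lipschitz dependence of the partition function on the inverse temperature. -/
lemma partitionFunction_le_exp_mul (Φ : Potential d S) (Λ : Finset (Site d)) (β γ : ℝ) :
    partitionFunction Φ Λ β ≤ Real.exp (|β - γ| * totalNorm Φ Λ) * partitionFunction Φ Λ γ := by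
  rw [partitionFunction, partitionFunction, Finset.mul_sum]
  refine Finset.sum_le_sum fun ω _ => ?_
  rw [← Real.exp_add]
  refine Real.exp_le_exp.2 ?_
  have h1 : -((β - γ) * hamiltonian Φ Λ ω) ≤ |β - γ| * totalNorm Φ Λ := by
    refine (neg_le_abs _).trans ?_
    rw [abs_mul]
    exact mul_le_mul_of_nonneg_left (abs_hamiltonian_le Φ Λ ω) (abs_nonneg _)
  linarith

lemma abs_log_partitionFunction_sub_le [Nonempty S] (Φ : Potential d S) (Λ : Finset (Site d))
    (β γ : ℝ) :
    |Real.log (partitionFunction Φ Λ β) - Real.log (partitionFunction Φ Λ γ)| ≤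
      |β - γ| * totalNorm Φ Λ := by
  have key : ∀ β γ : ℝ, Real.log (partitionFunction Φ Λ β) ≤
      |β - γ| * totalNorm Φ Λ + Real.log (partitionFunction Φ Λ γ) := fun β γ => by
    have := Real.log_le_log (partitionFunction_pos Φ Λ β) (partitionFunction_le_exp_mul Φ Λ β γ)
    rwa [Real.log_mul (Real.exp_pos _).ne' (partitionFunction_pos Φ Λ γ).ne', Real.log_exp]
      at this
  have h1 := key β γ
  have h2 := key γ β
  rw [abs_sub_comm γ β] at h2
  rw [abs_le]
  constructor <;> linarith

lemma log_partitionFunction_zero (Φ : Potential d S) (Λ : Finset (Site d)) :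
    Real.log (partitionFunction Φ Λ 0) = Λ.card * Real.log (Fintype.card S) := by
  simp [partitionFunction]

end Superadditive

/-! ### Multidimensional Fekete lemma -/

lemma mem_box {n : ℕ} {x : Site d} : x ∈ box d n ↔ ∀ i, |x i| ≤ n := by
  simp [box, abs_le]

lemma card_box (d n : ℕ) : (box d n).card = (2 * n + 1) ^ d := by
  rw [box, Fintype.card_piFinset_const, Int.card_Icc]
  congr 1
  omega

lemma card_box_pos (d n : ℕ) : (0 : ℝ) < (box d n).card := by
  rw [card_box]
  positivity

lemma sum_le_of_superadditive {L : Finset (Site d) → ℝ} (h0 : ∀ Λ, 0 ≤ L Λ)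
    (hsup : ∀ Λ₁ Λ₂, Disjoint Λ₁ Λ₂ → L Λ₁ + L Λ₂ ≤ L (Λ₁ ∪ Λ₂)) {ι : Type*} [DecidableEq ι]
    (T : Finset ι) (t : ι → Finset (Site d)) (ht : Pairwise fun i j => Disjoint (t i) (t j)) :
    ∑ i ∈ T, L (t i) ≤ L (T.biUnion t) := by
  induction T using Finset.induction_on with
  | empty => simpa using h0 ∅
  | insert i T hi ih =>
    rw [Finset.sum_insert hi, Finset.biUnion_insert]
    refine le_trans (by linarith) (hsup _ _ ?_)
    rw [Finset.disjoint_biUnion_right]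
    exact fun j hj => ht (by rintro rfl; exact hi hj)

/-- Disjoint copies of `box d m`, centred at `(2m+1) z` for `z ∈ box d q`, are packed into `box d
n`; `hn` is the condition that they fit. -/
lemma card_mul_le_of_superadditive {L : Finset (Site d) → ℝ} (h0 : ∀ Λ, 0 ≤ L Λ)
    (hsup : ∀ Λ₁ Λ₂, Disjoint Λ₁ Λ₂ → L Λ₁ + L Λ₂ ≤ L (Λ₁ ∪ Λ₂))
    (hinv : ∀ x Λ, L (translate x Λ) = L Λ) {m q n : ℕ} (hn : m + (2 * m + 1) * q ≤ n) :
    (box d q).card * L (box d m) ≤ L (box d n) := by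
  let t : Site d → Finset (Site d) := fun z => translate ((2 * m + 1 : ℤ) • z) (box d m)
  have hdisj : Pairwise fun z w => Disjoint (t z) (t w) := by
    intro z w hzw
    rw [Finset.disjoint_left]
    intro y hy hy'
    simp only [t, mem_translate, mem_box, Pi.sub_apply, Pi.smul_apply, smul_eq_mul] at hy hy'
    refine hzw (funext fun i => ?_)
    have h1 := abs_le.1 (hy i)
    have h2 := abs_le.1 (hy' i)
    have h3 : (2 * m + 1 : ℤ) * (z i - w i) = 0 :=
      Int.eq_zero_of_abs_lt_dvd (m := 2 * m + 1) ⟨_, rfl⟩ (by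
        rw [abs_lt]
        constructor <;> linarith [h1.1, h1.2, h2.1, h2.2])
    have h4 : (2 * m + 1 : ℤ) ≠ 0 := by positivity
    have := (mul_eq_zero.1 h3).resolve_left h4
    linarith
  have hsub : (box d q).biUnion t ⊆ box d n := by
    intro y hy
    obtain ⟨z, hz, hy⟩ := Finset.mem_biUnion.1 hy
    simp only [t, mem_translate, mem_box, Pi.sub_apply, Pi.smul_apply, smul_eq_mul] at hy hz ⊢
    intro i
    have h1 : |(2 * m + 1 : ℤ) * z i| ≤ (2 * m + 1) * q := by
      rw [abs_mul, abs_of_nonneg (by positivity : (0 : ℤ) ≤ 2 * m + 1)]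
      exact mul_le_mul_of_nonneg_left (hz i) (by positivity)
    have h2 : (m + (2 * m + 1) * q : ℤ) ≤ n := by exact_mod_cast hn
    calc |y i| = |(y i - (2 * m + 1) * z i) + (2 * m + 1) * z i| := by rw [sub_add_cancel]
      _ ≤ _ := (abs_add_le _ _).trans ((add_le_add (hy i) h1).trans h2)
  calc (box d q).card * L (box d m) = ∑ z ∈ box d q, L (t z) := by simp [t, hinv]
    _ ≤ L ((box d q).biUnion t) := sum_le_of_superadditive h0 hsup _ t hdisj
    _ ≤ L ((box d q).biUnion t) + L (box d n \ (box d q).biUnion t) :=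
        le_add_of_nonneg_right (h0 _)
    _ ≤ L (box d n) := by
        refine (hsup _ _ Finset.disjoint_sdiff).trans_eq ?_
        rw [Finset.union_sdiff_of_subset hsub]

/-- A non-negative, translation invariant, superadditive set function of at most linear growth
has a density along boxes. -/
theorem exists_tendsto_of_superadditive {L : Finset (Site d) → ℝ} (h0 : ∀ Λ, 0 ≤ L Λ)
    (hsup : ∀ Λ₁ Λ₂, Disjoint Λ₁ Λ₂ → L Λ₁ + L Λ₂ ≤ L (Λ₁ ∪ Λ₂))
    (hinv : ∀ x Λ, L (translate x Λ) = L Λ) {K : ℝ} (hK : ∀ Λ, L Λ ≤ K * Λ.card) :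
    ∃ l, Tendsto (fun n => L (box d n) / (box d n).card) atTop (𝓝 l) := by
  have hbdd : BddAbove (range fun n => L (box d n) / (box d n).card) :=
    ⟨K, by rintro _ ⟨n, rfl⟩; exact (div_le_iff₀ (card_box_pos d n)).2 (hK _)⟩
  refine ⟨⨆ n, L (box d n) / (box d n).card, tendsto_order.2 ⟨fun l hl => ?_, fun l hl => ?_⟩⟩
  · obtain ⟨m, hm⟩ := exists_lt_of_lt_ciSup hl
    have hlim : Tendsto (fun n : ℕ => (((2 * n + 1 - 4 * m : ℝ) / (2 * n + 1)) ^ d) *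
        (L (box d m) / (box d m).card)) atTop (𝓝 (L (box d m) / (box d m).card)) := by
      have h1 : Tendsto (fun n : ℕ => (4 * m : ℝ) / (2 * n + 1)) atTop (𝓝 0) := by
        refine tendsto_const_nhds.div_atTop (tendsto_atTop_mono (fun n : ℕ => ?_)
          tendsto_natCast_atTop_atTop)
        have : (0 : ℝ) ≤ n := n.cast_nonneg
        linarith
      have h2 : Tendsto (fun n : ℕ => (2 * n + 1 - 4 * m : ℝ) / (2 * n + 1)) atTop (𝓝 1) := by
        have := h1.const_sub 1
        rw [sub_zero] at this
        refine this.congr fun n => ?_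
        have : (2 * n + 1 : ℝ) ≠ 0 := by positivity
        field_simp
      simpa using (h2.pow d).mul_const (L (box d m) / (box d m).card)
    filter_upwards [hlim.eventually (lt_mem_nhds hm), eventually_ge_atTop (2 * m)] with n hn hmn
    refine hn.trans_le ?_
    -- The largest packing that fits. The tiled cube has side `(2m+1)(2q+1) ≥ 2n+1-4m`, so it fills
    -- a fraction of `box d n` tending to one.
    set q := (n - m) / (2 * m + 1) with hq
    have hdiv := Nat.div_add_mod (n - m) (2 * m + 1)
    have hmod := Nat.mod_lt (n - m) (show 0 < 2 * m + 1 by omega)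
    rw [← hq] at hdiv
    have hle : m + (2 * m + 1) * q ≤ n := by omega
    have hge : n ≤ 3 * m + (2 * m + 1) * q := by omega
    have hge' : (n : ℝ) ≤ 3 * m + (2 * m + 1) * q := by exact_mod_cast hge
    have hmn' : (2 * m : ℝ) ≤ n := by exact_mod_cast hmn
    have hkey := card_mul_le_of_superadditive h0 hsup hinv hle
    have hpow : ((2 * n + 1 - 4 * m : ℝ) / (2 * n + 1)) ^ d ≤
        (box d q).card * (box d m).card / (box d n).card := by
      rw [card_box, card_box, card_box]
      push_cast
      rw [← mul_pow, ← div_pow]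
      refine pow_le_pow_left₀ (div_nonneg (by linarith) (by positivity)) ?_ d
      refine div_le_div_of_nonneg_right ?_ (by positivity)
      linarith
    have hm0 := card_box_pos d m
    have hn0 := card_box_pos d n
    calc _ ≤ ((box d q).card * (box d m).card / (box d n).card : ℝ) *
          (L (box d m) / (box d m).card) :=
          mul_le_mul_of_nonneg_right hpow (div_nonneg (h0 _) hm0.le)
      _ = (box d q).card * L (box d m) / (box d n).card := by field_simp
      _ ≤ _ := div_le_div_of_nonneg_right hkey hn0.le
  · exact Eventually.of_forall fun n => (le_ciSup hbdd n).trans_lt hl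

/-! ### Existence of the pressure -/

section Pressure

variable [Fintype S] [Nonempty S] {Φ : Potential d S}

theorem tendsto_finitePressure (hinv : TranslationInvariant Φ) (hsum : AbsolutelySummable Φ)
    {β : ℝ} (hβ : 0 < β) :
    Tendsto (fun n => finitePressure Φ n β) atTop (𝓝 (pressure Φ β)) := by
  have hW := totalNorm_le hinv hsum
  have hlog : ∀ Λ, |Real.log (partitionFunction Φ Λ β) - Λ.card * Real.log (Fintype.card S)| ≤
      β * totalNorm Φ Λ := fun Λ => by
    have := abs_log_partitionFunction_sub_le Φ Λ β 0
    rwa [log_partitionFunction_zero, sub_zero, abs_of_pos hβ] at this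
  have hS : 0 ≤ Real.log (Fintype.card S) := Real.log_natCast_nonneg _
  -- Fekete is applied to `totalNorm` and to the corrected `log Z`, and the limits are subtracted.
  -- In the second growth constant one `β * siteNorm Φ` comes from comparison with `Z` at `β = 0`
  -- and the other from the correction.
  obtain ⟨l₁, h₁⟩ := exists_tendsto_of_superadditive (d := d) (totalNorm_nonneg Φ)
    (fun _ _ h => totalNorm_superadditive Φ h) (totalNorm_translate hinv) hW
  obtain ⟨l₂, h₂⟩ := exists_tendsto_of_superadditive (d := d)
    (L := fun Λ => Real.log (partitionFunction Φ Λ β) + β * totalNorm Φ Λ)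
    (K := Real.log (Fintype.card S) + 2 * β * siteNorm Φ)
    (fun Λ => by
      have h1 := (abs_le.1 (hlog Λ)).1
      have h2 : (0 : ℝ) ≤ Λ.card * Real.log (Fintype.card S) := by positivity
      linarith)
    (fun _ _ h => log_partitionFunction_superadditive Φ h hβ.le)
    (fun x Λ => by rw [partitionFunction_translate hinv, totalNorm_translate hinv])
    (fun Λ => by
      have h1 := (abs_le.1 (hlog Λ)).2
      have h2 := mul_le_mul_of_nonneg_left (hW Λ) hβ.le
      nlinarith)
  refine tendsto_nhds_limUnder ⟨β * l₁ - l₂, ((h₁.const_mul β).sub h₂).congr fun n => ?_⟩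
  rw [finitePressure]
  ring

lemma abs_finitePressure_sub_le (hinv : TranslationInvariant Φ) (hsum : AbsolutelySummable Φ)
    (n : ℕ) (β γ : ℝ) :
    |finitePressure Φ n β - finitePressure Φ n γ| ≤ siteNorm Φ * |β - γ| := by
  have h0 := card_box_pos d n
  have h1 := (abs_log_partitionFunction_sub_le Φ (box d n) β γ).trans
    (mul_le_mul_of_nonneg_left (totalNorm_le hinv hsum (box d n)) (abs_nonneg _))
  have h2 : finitePressure Φ n β - finitePressure Φ n γ =
      -((Real.log (partitionFunction Φ (box d n) β) -
        Real.log (partitionFunction Φ (box d n) γ)) / (box d n).card) := by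
    rw [finitePressure, finitePressure]
    ring
  rw [h2, abs_neg, abs_div, abs_of_pos h0, div_le_iff₀ h0]
  linarith

lemma abs_pressure_sub_le (hinv : TranslationInvariant Φ) (hsum : AbsolutelySummable Φ)
    {β γ : ℝ} (hβ : 0 < β) (hγ : 0 < γ) :
    |pressure Φ β - pressure Φ γ| ≤ siteNorm Φ * |β - γ| :=
  le_of_tendsto ((tendsto_finitePressure hinv hsum hβ).sub
    (tendsto_finitePressure hinv hsum hγ)).abs
    (Eventually.of_forall fun n => abs_finitePressure_sub_le hinv hsum n β γ)

/-- The Lipschitz bound survives the infinite-volume limit; it is what makes the endpoints `a` and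
`b` real numbers. -/
lemma abs_deriv_pressure_le (hinv : TranslationInvariant Φ) (hsum : AbsolutelySummable Φ)
    {β : ℝ} (hβ : 0 < β) : |deriv (pressure Φ) β| ≤ siteNorm Φ := by
  refine norm_deriv_le_of_lip' (𝕜 := ℝ) (f := pressure Φ) (siteNorm_nonneg Φ) ?_
  filter_upwards [lt_mem_nhds hβ] with γ hγ using abs_pressure_sub_le hinv hsum hγ hβ

end Pressure

/-! ### Gibbs expectations and the derivatives of the pressure -/

section Gibbs

variable [Fintype S] (Φ : Potential d S) (Λ : Finset (Site d)) (β : ℝ)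

lemma gibbsExpectation_eq_div (f : Config S Λ → ℝ) : gibbsExpectation Φ Λ β f =
    (∑ ω : Config S Λ, f ω * Real.exp (-β * hamiltonian Φ Λ ω)) / partitionFunction Φ Λ β := by
  simp only [gibbsExpectation, Finset.sum_div, mul_div_assoc]

lemma gibbsExpectation_sum {ι : Type*} (F : Finset ι) (f : ι → Config S Λ → ℝ) :
    gibbsExpectation Φ Λ β (fun ω => ∑ i ∈ F, f i ω) = ∑ i ∈ F, gibbsExpectation Φ Λ β (f i) := by
  simp only [gibbsExpectation, Finset.sum_mul]
  exact Finset.sum_comm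

lemma gibbsCov_sum_sum {ι : Type*} (F : Finset ι) (f : ι → Config S Λ → ℝ) :
    gibbsCov Φ Λ β (fun ω => ∑ i ∈ F, f i ω) (fun ω => ∑ i ∈ F, f i ω) =
      ∑ i ∈ F, ∑ j ∈ F, gibbsCov Φ Λ β (f i) (f j) := by
  simp only [gibbsCov, Finset.sum_mul_sum, gibbsExpectation_sum, Finset.sum_sub_distrib]

lemma gibbsCov_hamiltonian : gibbsCov Φ Λ β (hamiltonian Φ Λ) (hamiltonian Φ Λ) =
    ∑ A ∈ Λ.powerset with A.Nonempty, ∑ B ∈ Λ.powerset with B.Nonempty,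
      gibbsCov Φ Λ β (extend Φ Λ A) (extend Φ Λ B) :=
  gibbsCov_sum_sum Φ Λ β _ (extend Φ Λ)

lemma hasDerivAt_sum_mul_exp (f : Config S Λ → ℝ) :
    HasDerivAt (fun γ => ∑ ω : Config S Λ, f ω * Real.exp (-γ * hamiltonian Φ Λ ω))
      (-∑ ω : Config S Λ, f ω * hamiltonian Φ Λ ω * Real.exp (-β * hamiltonian Φ Λ ω)) β := by
  rw [← Finset.sum_neg_distrib]
  refine HasDerivAt.fun_sum fun ω _ => ?_
  have h1 : HasDerivAt (fun γ : ℝ => -γ * hamiltonian Φ Λ ω) (-1 * hamiltonian Φ Λ ω) β :=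
    (hasDerivAt_neg β).mul_const _
  exact (h1.exp.const_mul (f ω)).congr_deriv (by ring)

lemma hasDerivAt_partitionFunction : HasDerivAt (partitionFunction Φ Λ)
    (-∑ ω : Config S Λ, hamiltonian Φ Λ ω * Real.exp (-β * hamiltonian Φ Λ ω)) β := by
  have h := hasDerivAt_sum_mul_exp Φ Λ β fun _ => 1
  simp only [one_mul] at h
  exact h

variable [Nonempty S]

lemma sum_gibbsWeight :
    ∑ ω : Config S Λ, Real.exp (-β * hamiltonian Φ Λ ω) / partitionFunction Φ Λ β = 1 := by
  rw [← Finset.sum_div]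
  exact div_self (partitionFunction_pos Φ Λ β).ne'

lemma gibbsCov_self (f : Config S Λ → ℝ) : gibbsCov Φ Λ β f f =
    gibbsExpectation Φ Λ β fun ω => (f ω - gibbsExpectation Φ Λ β f) ^ 2 := by
  set m := gibbsExpectation Φ Λ β f with hm
  have h1 : ∀ ω : Config S Λ,
      (f ω - m) ^ 2 * (Real.exp (-β * hamiltonian Φ Λ ω) / partitionFunction Φ Λ β) =
      f ω * f ω * (Real.exp (-β * hamiltonian Φ Λ ω) / partitionFunction Φ Λ β) -
      2 * m * (f ω * (Real.exp (-β * hamiltonian Φ Λ ω) / partitionFunction Φ Λ β)) +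
      m ^ 2 * (Real.exp (-β * hamiltonian Φ Λ ω) / partitionFunction Φ Λ β) := fun ω => by ring
  have h2 : ∑ ω : Config S Λ,
      f ω * (Real.exp (-β * hamiltonian Φ Λ ω) / partitionFunction Φ Λ β) = m := rfl
  rw [gibbsCov, ← hm, gibbsExpectation, gibbsExpectation, Finset.sum_congr rfl fun ω _ => h1 ω,
    Finset.sum_add_distrib, Finset.sum_sub_distrib, ← Finset.mul_sum, ← Finset.mul_sum,
    sum_gibbsWeight, h2]
  ring

lemma hasDerivAt_log_partitionFunction :
    HasDerivAt (fun γ => Real.log (partitionFunction Φ Λ γ))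
      (-gibbsExpectation Φ Λ β (hamiltonian Φ Λ)) β := by
  rw [gibbsExpectation_eq_div, ← neg_div]
  exact (hasDerivAt_partitionFunction Φ Λ β).log (partitionFunction_pos Φ Λ β).ne'

/-- Fluctuation–dissipation: the second derivative of `log Z` is the energy variance, so convexity
estimates become variance estimates. -/
lemma hasDerivAt_gibbsExpectation_hamiltonian :
    HasDerivAt (fun γ => gibbsExpectation Φ Λ γ (hamiltonian Φ Λ))
      (-gibbsCov Φ Λ β (hamiltonian Φ Λ) (hamiltonian Φ Λ)) β := by
  have hZ := (partitionFunction_pos Φ Λ β).ne'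
  have h := (hasDerivAt_sum_mul_exp Φ Λ β (hamiltonian Φ Λ)).fun_div
    (hasDerivAt_partitionFunction Φ Λ β) hZ
  simp only [gibbsCov, gibbsExpectation_eq_div]
  refine h.congr_deriv ?_
  generalize (∑ ω : Config S Λ, hamiltonian Φ Λ ω * hamiltonian Φ Λ ω *
    Real.exp (-β * hamiltonian Φ Λ ω)) = p
  generalize (∑ ω : Config S Λ, hamiltonian Φ Λ ω * Real.exp (-β * hamiltonian Φ Λ ω)) = q
  field_simp
  ring

end Gibbs

/-! ### Finite energy: a uniform lower bound for local variances -/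

section FiniteEnergy

/-- The configuration `ω` with its values on `A` replaced by those of `η`. -/
def modify {Λ A : Finset (Site d)} (η : Config S A) (ω : Config S Λ) : Config S Λ :=
  fun z => if h : z.1 ∈ A then η ⟨z.1, h⟩ else ω z

variable {Λ A : Finset (Site d)}

lemma extend_modify_self (Φ : Potential d S) (h : A ⊆ Λ) (η : Config S A) (ω : Config S Λ) :
    extend Φ Λ A (modify η ω) = Φ A η := by
  rw [extend_of_subset Φ h]
  congr 1
  funext z
  simp [Finset.restrict₂, modify]

lemma extend_modify_of_disjoint (Φ : Potential d S) {B : Finset (Site d)} (h : Disjoint B A)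
    (η : Config S A) (ω : Config S Λ) : extend Φ Λ B (modify η ω) = extend Φ Λ B ω := by
  by_cases hB : B ⊆ Λ
  · rw [extend_of_subset Φ hB, extend_of_subset Φ hB]
    congr 1
    funext z
    simp [Finset.restrict₂, modify, Finset.disjoint_left.1 h z.2]
  · simp [extend, hB]

lemma abs_hamiltonian_modify_sub_le [Finite S] {Φ : Potential d S}
    (hinv : TranslationInvariant Φ) (hsum : AbsolutelySummable Φ) (η : Config S A)
    (ω : Config S Λ) :
    |hamiltonian Φ Λ (modify η ω) - hamiltonian Φ Λ ω| ≤ 2 * (siteNorm Φ * A.card) := by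
  classical
  rw [hamiltonian, hamiltonian, ← Finset.sum_sub_distrib]
  set P := {B ∈ Λ.powerset | B.Nonempty}
  calc |∑ B ∈ P, (extend Φ Λ B (modify η ω) - extend Φ Λ B ω)|
      ≤ ∑ B ∈ P, |extend Φ Λ B (modify η ω) - extend Φ Λ B ω| := Finset.abs_sum_le_sum_abs _ _
    _ ≤ ∑ B ∈ P, if ∃ x ∈ A, x ∈ B then 2 * supNorm Φ B else 0 := by
        refine Finset.sum_le_sum fun B _ => ?_
        split_ifs with h
        · have h1 := abs_extend_le Φ Λ B (modify η ω)
          have h2 := abs_extend_le Φ Λ B ω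
          exact (abs_sub _ _).trans (by linarith)
        · rw [extend_modify_of_disjoint, sub_self, abs_zero]
          exact Finset.disjoint_left.2 fun x hx hxA => h ⟨x, hxA, hx⟩
    _ = 2 * ∑ B ∈ P with ∃ x ∈ A, x ∈ B, supNorm Φ B := by
        rw [← Finset.sum_filter, Finset.mul_sum]
    _ ≤ 2 * (siteNorm Φ * A.card) := by
        gcongr
        exact sum_supNorm_le_card_mul hinv hsum A _ fun B hB => (Finset.mem_filter.1 hB).2

variable [Fintype S]

/-- Overwriting on `A` forgets only `ω|_A`, so `modify η` is at most `|S|^|A|`-to-one. -/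
lemma sum_modify_le (hA : A ⊆ Λ) (η : Config S A) {g : Config S Λ → ℝ} (hg : ∀ ω, 0 ≤ g ω) :
    ∑ ω : Config S Λ, g (modify η ω) ≤
      (Fintype.card S : ℝ) ^ A.card * ∑ ω : Config S Λ, g ω := by
  classical
  let φ : Config S Λ → Config S A × Config S Λ := fun ω =>
    (Finset.restrict₂ (π := fun _ => S) hA ω, modify η ω)
  have hφ : Function.Injective φ := by
    intro ω ω' h
    rw [Prod.mk.injEq] at h
    funext z
    by_cases hz : z.1 ∈ A
    · exact congrFun h.1 ⟨z.1, hz⟩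
    · have := congrFun h.2 z
      simpa [modify, hz] using this
  calc ∑ ω : Config S Λ, g (modify η ω) = ∑ p ∈ Finset.univ.image φ, g p.2 :=
        (Finset.sum_image (f := fun p : Config S A × Config S Λ => g p.2)
          (fun ω _ ω' _ h => hφ h)).symm
    _ ≤ ∑ p : Config S A × Config S Λ, g p.2 :=
        Finset.sum_le_univ_sum_of_nonneg fun p => hg p.2
    _ = _ := by
        rw [Fintype.sum_prod_type]
        simp

/-- Imposing a pattern on `A` costs at most a factor `K` in weight, whatever happens outside, so
both `Φ A η` and `Φ A η'` contribute to the variance, and the mean cannot be close to both. The `4`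
is two such terms in `(x - y)² ≤ 2 (x - m)² + 2 (y - m)²`. -/
theorem sq_sub_le_mul_gibbsCov [Nonempty S] {Φ : Potential d S} (hinv : TranslationInvariant Φ)
    (hsum : AbsolutelySummable Φ) (hA : A ⊆ Λ) (η η' : Config S A) {β : ℝ} (hβ : 0 ≤ β) :
    (Φ A η - Φ A η') ^ 2 ≤ 4 * Real.exp (β * (2 * (siteNorm Φ * A.card))) *
      (Fintype.card S : ℝ) ^ A.card * gibbsCov Φ Λ β (extend Φ Λ A) (extend Φ Λ A) := by
  set K := Real.exp (β * (2 * (siteNorm Φ * A.card))) with hK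
  set f := extend Φ Λ A with hf
  set m := gibbsExpectation Φ Λ β f with hm
  set w : Config S Λ → ℝ := fun ω =>
    Real.exp (-β * hamiltonian Φ Λ ω) / partitionFunction Φ Λ β with hw
  have hZ := partitionFunction_pos Φ Λ β
  have hw0 : ∀ ω, 0 ≤ w ω := fun ω => by positivity
  have hV : gibbsCov Φ Λ β f f = ∑ ω, (f ω - m) ^ 2 * w ω := gibbsCov_self Φ Λ β f
  have hwK : ∀ (ζ : Config S A) ω, w ω ≤ K * w (modify ζ ω) := fun ζ ω => by
    rw [hw, hK, ← mul_div_assoc, ← Real.exp_add]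
    refine div_le_div_of_nonneg_right (Real.exp_le_exp.2 ?_) hZ.le
    have := (abs_le.1 (abs_hamiltonian_modify_sub_le hinv hsum ζ ω)).2
    nlinarith
  have hone : ∀ ζ : Config S A, (Φ A ζ - m) ^ 2 ≤
      K * ((Fintype.card S : ℝ) ^ A.card * gibbsCov Φ Λ β f f) := fun ζ => by
    calc (Φ A ζ - m) ^ 2 = ∑ ω, (Φ A ζ - m) ^ 2 * w ω := by
          rw [← Finset.mul_sum, sum_gibbsWeight, mul_one]
      _ ≤ ∑ ω, K * ((f (modify ζ ω) - m) ^ 2 * w (modify ζ ω)) := by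
          refine Finset.sum_le_sum fun ω _ => ?_
          rw [hf, extend_modify_self Φ hA, mul_left_comm]
          exact mul_le_mul_of_nonneg_left (hwK ζ ω) (sq_nonneg _)
      _ ≤ _ := by
          rw [← Finset.mul_sum, hV]
          exact mul_le_mul_of_nonneg_left (sum_modify_le hA ζ
            (g := fun ω => (f ω - m) ^ 2 * w ω)
            fun ω => mul_nonneg (sq_nonneg _) (hw0 ω)) (Real.exp_pos _).le
  nlinarith [hone η, hone η', sq_nonneg ((Φ A η - m) + (Φ A η' - m))]

end FiniteEnergy

/-! ### Strong concavity of the pressure -/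

section StrongConcavity

/-- The sum of the points of `A` moves by `|A| x`, which determines `x`. Hence distinct shifts give
distinct terms of the Hamiltonian. -/
lemma translate_left_injective {A : Finset (Site d)} (hA : A.Nonempty) :
    Function.Injective fun x => translate x A := by
  intro x y h
  have hsum : ∀ x : Site d, ∑ z ∈ translate x A, z = ∑ z ∈ A, z + A.card • x := fun x => by
    rw [translate, Finset.sum_map]
    simp [Finset.sum_add_distrib]
  have h1 : ∑ z ∈ translate x A, z = ∑ z ∈ translate y A, z := by
    simp only at h
    rw [h]
  rw [hsum, hsum, add_right_inj] at h1
  funext i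
  have h2 := congrFun h1 i
  simp only [Pi.smul_apply, nsmul_eq_mul] at h2
  exact mul_left_cancel₀ (Nat.cast_ne_zero.2 hA.card_pos.ne') h2

lemma exists_subset_box (A : Finset (Site d)) : ∃ k, A ⊆ box d k := by
  refine ⟨A.sup fun x => Finset.univ.sup fun i => (x i).natAbs, fun x hx => mem_box.2 fun i => ?_⟩
  have h1 : (x i).natAbs ≤ Finset.univ.sup fun i => (x i).natAbs :=
    Finset.le_sup (f := fun i => (x i).natAbs) (Finset.mem_univ i)
  have h2 := h1.trans (Finset.le_sup (f := fun x : Site d => Finset.univ.sup fun i =>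
    (x i).natAbs) hx)
  rw [Int.abs_eq_natAbs]
  exact_mod_cast h2

lemma translate_subset_box {A : Finset (Site d)} {k n : ℕ} (hA : A ⊆ box d k) (hkn : k ≤ n)
    {x : Site d} (hx : x ∈ box d (n - k)) : translate x A ⊆ box d n := by
  intro y hy
  have h1 := mem_box.1 (hA (mem_translate.1 hy))
  rw [mem_box] at hx ⊢
  intro i
  have h2 := hx i
  have h3 := h1 i
  rw [Pi.sub_apply] at h3
  rw [Nat.cast_sub hkn] at h2
  rw [abs_le] at h2 h3 ⊢
  constructor <;> linarith [h2.1, h2.2, h3.1, h3.2]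

lemma card_box_le (d : ℕ) {k n : ℕ} (hkn : k ≤ n) :
    ((box d n).card : ℝ) ≤ (2 * k + 1) ^ d * (box d (n - k)).card := by
  rw [card_box, card_box]
  push_cast
  rw [← mul_pow, Nat.cast_sub hkn]
  have h : (k : ℝ) ≤ n := by exact_mod_cast hkn
  refine pow_le_pow_left₀ (by positivity) ?_ d
  nlinarith [(Nat.cast_nonneg k : (0 : ℝ) ≤ k)]

variable [Fintype S] {Φ : Potential d S}

/-- All covariances in the expansion of the energy variance are non-negative, so any of them may be
dropped. -/
lemma sum_gibbsCov_self_le (hcorr : PositivelyCorrelated Φ) (Λ : Finset (Site d)) {β : ℝ}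
    (hβ : 0 < β) {F : Finset (Finset (Site d))} (hF : ∀ A ∈ F, A ⊆ Λ ∧ A.Nonempty) :
    ∑ A ∈ F, gibbsCov Φ Λ β (extend Φ Λ A) (extend Φ Λ A) ≤
      gibbsCov Φ Λ β (hamiltonian Φ Λ) (hamiltonian Φ Λ) := by
  rw [gibbsCov_hamiltonian]
  set P := {A ∈ Λ.powerset | A.Nonempty} with hP
  have hmem : ∀ A ∈ P, A ⊆ Λ ∧ A.Nonempty := fun A hA => by
    simpa [hP] using hA
  have hcov : ∀ A ∈ P, ∀ B ∈ P, 0 ≤ gibbsCov Φ Λ β (extend Φ Λ A) (extend Φ Λ B) :=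
    fun A hA B hB =>
      hcorr Λ A B (hmem A hA).1 (hmem B hB).1 (hmem A hA).2 (hmem B hB).2 β hβ
  calc _ ≤ ∑ A ∈ P, gibbsCov Φ Λ β (extend Φ Λ A) (extend Φ Λ A) :=
        Finset.sum_le_sum_of_subset_of_nonneg (fun A hA => by simpa [hP] using hF A hA)
          fun A hA _ => hcov A hA A hA
    _ ≤ _ := Finset.sum_le_sum fun A hA => Finset.single_le_sum
        (f := fun B => gibbsCov Φ Λ β (extend Φ Λ A) (extend Φ Λ B)) (fun B hB => hcov A hA B hB) hA

/-- The energy variance per site is bounded below, uniformly in the volume and locally uniformly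
in the temperature. -/
theorem exists_card_mul_le_gibbsCov_hamiltonian [Nonempty S] (hinv : TranslationInvariant Φ)
    (hsum : AbsolutelySummable Φ) (hconst : NonConstant Φ) (hcorr : PositivelyCorrelated Φ)
    (B : ℝ) : ∃ c > 0, ∃ k : ℕ, ∀ n, k ≤ n → ∀ β, 0 < β → β < B →
      2 * c * (box d n).card ≤
        gibbsCov Φ (box d n) β (hamiltonian Φ (box d n)) (hamiltonian Φ (box d n)) := by
  obtain ⟨A, hA, η, η', hne⟩ := hconst
  obtain ⟨k, hk⟩ := exists_subset_box A
  -- The finite-energy constant with `β` replaced by its upper bound `B`, hence uniform in the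
  -- temperature.
  set M := 4 * Real.exp (B * (2 * (siteNorm Φ * A.card))) * (Fintype.card S : ℝ) ^ A.card with hM
  have hcard : (0 : ℝ) < Fintype.card S := by exact_mod_cast Fintype.card_pos
  have hM0 : 0 < M := by positivity
  have hδ : 0 < (Φ A η - Φ A η') ^ 2 := by
    have := sub_ne_zero.2 hne
    positivity
  set v := (Φ A η - Φ A η') ^ 2 / M with hv
  have hv0 : 0 < v := by positivity
  -- About one local variance is gained per site of the shrunken box, which holds at least a
  -- fraction `(2k+1)^(-d)` of all sites; the `2` cancels that of `2 * c`.
  refine ⟨v / (2 * (2 * k + 1) ^ d), by positivity, k, fun n hn β hβ hβB => ?_⟩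
  have hlocal : ∀ x ∈ box d (n - k), v ≤ gibbsCov Φ (box d n) β
      (extend Φ (box d n) (translate x A)) (extend Φ (box d n) (translate x A)) := by
    intro x hx
    have hsub := translate_subset_box hk hn hx
    obtain ⟨ζ, rfl⟩ := (pullback_bijective x A).surjective η
    obtain ⟨ζ', rfl⟩ := (pullback_bijective x A).surjective η'
    have h1 := sq_sub_le_mul_gibbsCov hinv hsum hsub ζ ζ' hβ.le
    rw [hinv x A hA, hinv x A hA, card_translate] at h1
    rw [hv, div_le_iff₀ hM0, mul_comm]
    refine h1.trans (mul_le_mul_of_nonneg_right ?_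
      (hcorr _ _ _ hsub hsub (translate_nonempty.2 hA) (translate_nonempty.2 hA) β hβ))
    rw [hM]
    have := siteNorm_nonneg Φ
    gcongr
  have hinj := translate_left_injective hA
  have h2 := sum_gibbsCov_self_le hcorr (box d n) hβ
    (F := (box d (n - k)).image fun x => translate x A) (fun A' hA' => by
      obtain ⟨x, hx, rfl⟩ := Finset.mem_image.1 hA'
      exact ⟨translate_subset_box hk hn hx, translate_nonempty.2 hA⟩)
  rw [Finset.sum_image fun x _ y _ h => hinj h] at h2
  have h3 : ((box d (n - k)).card : ℝ) * v ≤
      gibbsCov Φ (box d n) β (hamiltonian Φ (box d n)) (hamiltonian Φ (box d n)) := by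
    simpa using (Finset.card_nsmul_le_sum _ _ _ hlocal).trans h2
  refine le_trans ?_ h3
  have h4 := card_box_le d hn
  have hk0 : (0 : ℝ) < (2 * k + 1) ^ d := by positivity
  calc 2 * (v / (2 * (2 * k + 1) ^ d)) * (box d n).card
      = v / (2 * k + 1) ^ d * (box d n).card := by field_simp
    _ ≤ v / (2 * k + 1) ^ d * ((2 * k + 1) ^ d * (box d (n - k)).card) := by gcongr
    _ = _ := by field_simp

/-- The variance bound makes the second derivative of `finitePressure + c β²` non-positive for large
volumes, and concavity passes to pointwise limits. -/
theorem exists_concaveOn_pressure_add [Nonempty S] (hinv : TranslationInvariant Φ)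
    (hsum : AbsolutelySummable Φ) (hconst : NonConstant Φ) (hcorr : PositivelyCorrelated Φ)
    (B : ℝ) : ∃ c > 0, ConcaveOn ℝ (Ioo 0 B) fun β => pressure Φ β + c * β ^ 2 := by
  obtain ⟨c, hc0, k, hk⟩ := exists_card_mul_le_gibbsCov_hamiltonian hinv hsum hconst hcorr B
  refine ⟨c, hc0, convex_Ioo 0 B, fun x hx y hy p q hp hq hpq => ?_⟩
  have hfin : ∀ n, k ≤ n → ConcaveOn ℝ (Ioo 0 B) fun β => finitePressure Φ n β + c * β ^ 2 := by
    intro n hn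
    have h0 := card_box_pos d n
    have hd1 : ∀ β, HasDerivAt (fun β => finitePressure Φ n β + c * β ^ 2)
        (-(1 / ((box d n).card : ℝ)) * -gibbsExpectation Φ (box d n) β (hamiltonian Φ (box d n)) +
          c * (2 * β)) β := fun β =>
      (((hasDerivAt_log_partitionFunction Φ (box d n) β).const_mul
        (-(1 / ((box d n).card : ℝ)))).fun_add
          ((hasDerivAt_pow 2 β).const_mul c)).congr_deriv (by simp)
    have hd2 : ∀ β, HasDerivAt (fun β => -(1 / ((box d n).card : ℝ)) *
        -gibbsExpectation Φ (box d n) β (hamiltonian Φ (box d n)) + c * (2 * β))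
        (-(1 / ((box d n).card : ℝ)) * - -gibbsCov Φ (box d n) β (hamiltonian Φ (box d n))
          (hamiltonian Φ (box d n)) + c * (2 * 1)) β := fun β =>
      ((hasDerivAt_gibbsExpectation_hamiltonian Φ (box d n) β).fun_neg.const_mul _).fun_add
        (((hasDerivAt_id β).const_mul 2).const_mul c)
    refine concaveOn_of_hasDerivWithinAt2_nonpos (convex_Ioo 0 B)
      (fun β _ => (hd1 β).continuousAt.continuousWithinAt)
      (fun β _ => (hd1 β).hasDerivWithinAt) (fun β _ => (hd2 β).hasDerivWithinAt) ?_
    rw [interior_Ioo]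
    intro β hβ
    have h1 := hk n hn β hβ.1 hβ.2
    rw [← le_div_iff₀ h0] at h1
    rw [neg_neg, neg_mul, one_div_mul_eq_div]
    linarith
  have hlim : ∀ β, 0 < β → Tendsto (fun n => finitePressure Φ n β + c * β ^ 2) atTop
      (𝓝 (pressure Φ β + c * β ^ 2)) := fun β hβ =>
    (tendsto_finitePressure hinv hsum hβ).add_const _
  refine le_of_tendsto_of_tendsto (((hlim x hx.1).const_smul p).add ((hlim y hy.1).const_smul q))
    (hlim _ (convex_Ioo 0 B hx hy hp hq hpq).1) ?_
  filter_upwards [eventually_ge_atTop k] with n hn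
  exact (hfin n hn).2 hx hy hp hq hpq

end StrongConcavity

/-! ### Large deviations of the energy density -/

section LargeDeviations

variable [Fintype S] {Φ : Potential d S}

/-- Exponential Markov inequality. The sign of `t` selects the tail: `t ≥ 0` for low energies, `t ≤
0` for high ones. -/
lemma sum_exp_le_exp_mul_partitionFunction (Φ : Potential d S) {Λ : Finset (Site d)}
    {V : Finset (Config S Λ)} {β t y : ℝ} (hV : ∀ ω ∈ V, t * hamiltonian Φ Λ ω ≤ t * y) :
    ∑ ω ∈ V, Real.exp (-β * hamiltonian Φ Λ ω) ≤
      Real.exp (t * y) * partitionFunction Φ Λ (β + t) := by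
  rw [partitionFunction, Finset.mul_sum]
  refine (Finset.sum_le_sum fun ω hω => ?_).trans
    (Finset.sum_le_univ_sum_of_nonneg fun ω => by positivity)
  rw [← Real.exp_add]
  refine Real.exp_le_exp.2 ?_
  linarith [hV ω hω]

lemma card_le_exp_mul_partitionFunction (Φ : Potential d S) {Λ : Finset (Site d)}
    {V : Finset (Config S Λ)} {β y : ℝ} (hβ : 0 ≤ β) (hV : ∀ ω ∈ V, hamiltonian Φ Λ ω ≤ y) :
    (V.card : ℝ) ≤ Real.exp (β * y) * partitionFunction Φ Λ β := by
  simpa using sum_exp_le_exp_mul_partitionFunction Φ (β := 0) (t := β)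
    fun ω hω => mul_le_mul_of_nonneg_left (hV ω hω) hβ

variable [Nonempty S]

lemma partitionFunction_box_eq_exp (Φ : Potential d S) (n : ℕ) (β : ℝ) :
    partitionFunction Φ (box d n) β = Real.exp (-((box d n).card * finitePressure Φ n β)) := by
  have h0 := (card_box_pos d n).ne'
  have h1 : -((box d n).card * finitePressure Φ n β) =
      Real.log (partitionFunction Φ (box d n) β) := by
    rw [finitePressure]
    field_simp
  rw [h1, Real.exp_log (partitionFunction_pos Φ _ β)]

lemma tendsto_card_box (hd : 0 < d) : Tendsto (fun n => ((box d n).card : ℝ)) atTop atTop := by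
  refine tendsto_atTop_mono (fun n => ?_) tendsto_natCast_atTop_atTop
  rw [card_box]
  exact_mod_cast (show n ≤ 2 * n + 1 by omega).trans (Nat.le_self_pow hd.ne' _)

/-- Chebyshev bound: the Gibbs probability of a large deviation is eventually small. -/
lemma eventually_sum_exp_le (hd : 0 < d) (hinv : TranslationInvariant Φ)
    (hsum : AbsolutelySummable Φ) {β t v : ℝ} (hβ : 0 < β) (hβt : 0 < β + t)
    (hneg : t * v - pressure Φ (β + t) + pressure Φ β < 0)
    (V : ∀ n, Finset (Config S (box d n)))
    (hV : ∀ n, ∀ ω ∈ V n, t * hamiltonian Φ (box d n) ω ≤ t * ((box d n).card * v)) :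
    ∀ᶠ n in atTop, ∑ ω ∈ V n, Real.exp (-β * hamiltonian Φ (box d n) ω) ≤
      partitionFunction Φ (box d n) β / 4 := by
  have hlim := ((tendsto_finitePressure hinv hsum hβt).const_sub (t * v)).add
    (tendsto_finitePressure hinv hsum hβ)
  have hexp := Real.tendsto_exp_atBot.comp ((tendsto_card_box (d := d) hd).atTop_mul_neg hneg hlim)
  filter_upwards [hexp.eventually (ge_mem_nhds (show (0 : ℝ) < 1 / 4 by norm_num))] with n hn
  refine (sum_exp_le_exp_mul_partitionFunction Φ (hV n)).trans ?_
  simp only [Function.comp_apply] at hn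
  rw [partitionFunction_box_eq_exp, partitionFunction_box_eq_exp, ← Real.exp_add]
  calc _ = Real.exp ((box d n).card * (t * v - finitePressure Φ n (β + t) + finitePressure Φ n β)) *
        Real.exp (-((box d n).card * finitePressure Φ n β)) := by
        rw [← Real.exp_add]
        ring_nf
    _ ≤ 1 / 4 * Real.exp (-((box d n).card * finitePressure Φ n β)) :=
        mul_le_mul_of_nonneg_right hn (Real.exp_pos _).le
    _ = _ := by ring

/-- Exponential tilting: the number of configurations whose energy density is close to `ψ'(β)`
is bounded below. -/
theorem eventually_lt_log_card_div (hd : 0 < d) (hinv : TranslationInvariant Φ)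
    (hsum : AbsolutelySummable Φ) (hψ : ∀ β, 0 < β → DifferentiableAt ℝ (pressure Φ) β)
    {β w v l : ℝ} (hβ : 0 < β) (hw : w < deriv (pressure Φ) β) (hv : deriv (pressure Φ) β < v)
    (hl : l < β * w - pressure Φ β) (V : ∀ n, Finset (Config S (box d n)))
    (hV : ∀ n ω, w < hamiltonian Φ (box d n) ω / (box d n).card →
      hamiltonian Φ (box d n) ω / (box d n).card < v → ω ∈ V n) :
    ∀ᶠ n in atTop, 0 < (V n).card ∧ l < Real.log (V n).card / (box d n).card := by
  classical
  set u := deriv (pressure Φ) β with hu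
  have hder : HasDerivAt (pressure Φ) u β := (hψ β hβ).hasDerivAt
  -- This Chernoff exponent vanishes at `t = 0` with slope `y - u`, so it is negative for a small `t
  -- > 0` if `y = w < u` and for a small `t < 0` if `y = v > u`.
  have hshift : ∀ y, HasDerivAt (fun t => t * y - pressure Φ (β + t) + pressure Φ β) (y - u) 0 := by
    intro y
    have h1 : HasDerivAt (fun t => pressure Φ (β + t)) u 0 := by
      refine HasDerivAt.comp_const_add β 0 ?_
      rwa [add_zero]
    simpa using (((hasDerivAt_id (0 : ℝ)).mul_const y).fun_sub h1).add_const (pressure Φ β)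
  have hpos : ∀ᶠ t in 𝓝 (0 : ℝ), 0 < β + t :=
    (continuous_const.add continuous_id).continuousAt.eventually (lt_mem_nhds (by simpa using hβ))
  have hright : ∃ t > 0, 0 < β + t ∧ t * w - pressure Φ (β + t) + pressure Φ β < 0 := by
    have h1 := (hasDerivAt_iff_tendsto_slope_zero.1 (hshift w)).mono_left
      (nhdsWithin_mono _ fun t ht => (ne_of_gt ht : t ≠ (0 : ℝ)) : 𝓝[>] (0 : ℝ) ≤ _)
    obtain ⟨t, ⟨ht, ht'⟩, ht0⟩ := ((h1.eventually (gt_mem_nhds (sub_neg.2 hw))).and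
      (hpos.filter_mono nhdsWithin_le_nhds)).and self_mem_nhdsWithin |>.exists
    have ht0' : 0 < t := ht0
    refine ⟨t, ht0, ht', ?_⟩
    simp only [zero_add, zero_mul, add_zero, zero_sub, neg_add_cancel, sub_zero, smul_eq_mul]
      at ht
    by_contra hcon
    exact absurd ht (not_lt.2 (mul_nonneg (inv_pos.2 ht0').le (not_lt.1 hcon)))
  have hleft : ∃ t < 0, 0 < β + t ∧ t * v - pressure Φ (β + t) + pressure Φ β < 0 := by
    have h1 := (hasDerivAt_iff_tendsto_slope_zero.1 (hshift v)).mono_left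
      (nhdsWithin_mono _ fun t ht => (ne_of_lt ht : t ≠ (0 : ℝ)) : 𝓝[<] (0 : ℝ) ≤ _)
    obtain ⟨t, ⟨ht, ht'⟩, ht0⟩ := ((h1.eventually (lt_mem_nhds (sub_pos.2 hv))).and
      (hpos.filter_mono nhdsWithin_le_nhds)).and self_mem_nhdsWithin |>.exists
    have ht0' : t < 0 := ht0
    refine ⟨t, ht0, ht', ?_⟩
    simp only [zero_add, zero_mul, add_zero, zero_sub, neg_add_cancel, sub_zero, smul_eq_mul]
      at ht
    by_contra hcon
    exact absurd ht (not_lt.2 (mul_nonpos_of_nonpos_of_nonneg (inv_lt_zero.2 ht0').le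
      (not_lt.1 hcon)))
  obtain ⟨t₁, ht₁, hβt₁, hneg₁⟩ := hright
  obtain ⟨t₂, ht₂, hβt₂, hneg₂⟩ := hleft
  -- Each tail carries at most a quarter of `Z`, leaving half for the window. There every weight is
  -- at most `exp (-β N w)`, `N` being the number of sites, which forces many configurations.
  have e₁ := eventually_sum_exp_le hd hinv hsum hβ hβt₁ hneg₁
    (fun n => Finset.univ.filter fun ω =>
      hamiltonian Φ (box d n) ω ≤ (box d n).card * w) fun n ω hω =>
      mul_le_mul_of_nonneg_left (Finset.mem_filter.1 hω).2 ht₁.le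
  have e₂ := eventually_sum_exp_le hd hinv hsum hβ hβt₂ hneg₂
    (fun n => Finset.univ.filter fun ω =>
      (box d n).card * v ≤ hamiltonian Φ (box d n) ω) fun n ω hω =>
      mul_le_mul_of_nonpos_left (Finset.mem_filter.1 hω).2 ht₂.le
  have hlim : Tendsto (fun n => β * w - finitePressure Φ n β - Real.log 2 / (box d n).card) atTop
      (𝓝 (β * w - pressure Φ β)) := by
    simpa using ((tendsto_finitePressure hinv hsum hβ).const_sub (β * w)).sub
      ((tendsto_const_nhds (x := Real.log 2)).div_atTop (tendsto_card_box (d := d) hd))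
  filter_upwards [e₁, e₂, hlim.eventually (lt_mem_nhds hl)] with n h₁ h₂ h₃
  have hN := card_box_pos d n
  set Z := partitionFunction Φ (box d n) β with hZdef
  have hZ : 0 < Z := partitionFunction_pos Φ (box d n) β
  set W := Finset.univ.filter fun ω : Config S (box d n) =>
    (box d n).card * w < hamiltonian Φ (box d n) ω ∧
      hamiltonian Φ (box d n) ω < (box d n).card * v with hW
  have hsplit : Z ≤ (∑ ω with hamiltonian Φ (box d n) ω ≤ (box d n).card * w,
        Real.exp (-β * hamiltonian Φ (box d n) ω)) +
      (∑ ω with (box d n).card * v ≤ hamiltonian Φ (box d n) ω,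
        Real.exp (-β * hamiltonian Φ (box d n) ω)) +
      ∑ ω ∈ W, Real.exp (-β * hamiltonian Φ (box d n) ω) := by
    rw [hZdef, partitionFunction, hW, Finset.sum_filter, Finset.sum_filter, Finset.sum_filter,
      ← Finset.sum_add_distrib, ← Finset.sum_add_distrib]
    refine Finset.sum_le_sum fun ω _ => ?_
    have hexp := Real.exp_pos (-β * hamiltonian Φ (box d n) ω)
    rcases le_or_gt (hamiltonian Φ (box d n) ω) ((box d n).card * w) with h | h
    · rw [if_pos h]
      split_ifs <;> linarith
    · rcases le_or_gt ((box d n).card * v) (hamiltonian Φ (box d n) ω) with h' | h'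
      · rw [if_pos h']
        split_ifs <;> linarith
      · rw [if_neg h.not_ge, if_neg h'.not_ge, if_pos ⟨h, h'⟩]
        linarith
  have hcard : ∑ ω ∈ W, Real.exp (-β * hamiltonian Φ (box d n) ω) ≤
      W.card * Real.exp (-(β * ((box d n).card * w))) := by
    rw [← nsmul_eq_mul]
    refine Finset.sum_le_card_nsmul _ _ _ fun ω hω => Real.exp_le_exp.2 ?_
    have := mul_le_mul_of_nonneg_left (Finset.mem_filter.1 hω).2.1.le hβ.le
    linarith
  have hWV : W ⊆ V n := by
    intro ω hω
    obtain ⟨-, h, h'⟩ := Finset.mem_filter.1 hω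
    exact hV n ω ((lt_div_iff₀ hN).2 (by linarith)) ((div_lt_iff₀ hN).2 (by linarith))
  have hVW : (W.card : ℝ) ≤ (V n).card := by exact_mod_cast Finset.card_le_card hWV
  have hmain : Z / 2 * Real.exp (β * ((box d n).card * w)) ≤ (V n).card := by
    refine le_trans ?_ hVW
    have h4 : Z / 2 ≤ W.card * Real.exp (-(β * ((box d n).card * w))) := by linarith
    rw [Real.exp_neg, ← div_eq_mul_inv, le_div_iff₀ (Real.exp_pos _)] at h4
    exact h4
  have hV0 : (0 : ℝ) < (V n).card := lt_of_lt_of_le (by positivity) hmain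
  refine ⟨by exact_mod_cast hV0, h₃.trans_le ?_⟩
  rw [le_div_iff₀ hN]
  have hlog := Real.log_le_log (by positivity) hmain
  rw [Real.log_mul (by positivity) (Real.exp_pos _).ne', Real.log_exp,
    Real.log_div hZ.ne' two_ne_zero, hZdef, partitionFunction_box_eq_exp, Real.log_exp] at hlog
  have h5 : (β * w - finitePressure Φ n β - Real.log 2 / (box d n).card) * (box d n).card =
      β * ((box d n).card * w) - (box d n).card * finitePressure Φ n β - Real.log 2 := by
    field_simp
  rw [h5]
  linarith

/-- The exponential growth rate of the number of configurations in sets that lie below the energy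
density `v` and contain an energy window ending at `v`. -/
theorem tendsto_log_card_div (hd : 0 < d) (hinv : TranslationInvariant Φ)
    (hsum : AbsolutelySummable Φ) (hψ : ∀ β, 0 < β → DifferentiableAt ℝ (pressure Φ) β)
    {w v l : ℝ} (V : ∀ n, Finset (Config S (box d n)))
    (hle : ∀ n, ∀ ω ∈ V n, hamiltonian Φ (box d n) ω ≤ (box d n).card * v)
    (hV : ∀ n ω, w < hamiltonian Φ (box d n) ω / (box d n).card →
      hamiltonian Φ (box d n) ω / (box d n).card < v → ω ∈ V n)
    (hl : IsGLB ((fun β => β * v - pressure Φ β) '' Ioi 0) l)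
    (hex : ∀ η > 0, ∃ β > 0, w < deriv (pressure Φ) β ∧ deriv (pressure Φ) β < v ∧
      β * (v - deriv (pressure Φ) β) < η) :
    (∀ᶠ n in atTop, 0 < (V n).card) ∧
      Tendsto (fun n => Real.log (V n).card / (box d n).card) atTop (𝓝 l) := by
  have hlower : ∀ l' < l, ∀ᶠ n in atTop,
      0 < (V n).card ∧ l' < Real.log (V n).card / (box d n).card := by
    intro l' hl'
    -- Tilting needs a mean energy strictly inside the window, so the optimal `β` (with `ψ' = v`, if
    -- any) is replaced by one that loses less than `l - l'`.
    obtain ⟨β, hβ, h1, h2, h3⟩ := hex (l - l') (sub_pos.2 hl')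
    have h4 : l ≤ β * v - pressure Φ β := hl.1 ⟨β, hβ, rfl⟩
    set u := deriv (pressure Φ) β
    have h5 : l' < β * u - pressure Φ β := by linarith
    have h6 : ∀ᶠ y in 𝓝[<] u, l' < β * y - pressure Φ β ∧ w < y :=
      (((continuous_const.mul continuous_id).sub continuous_const).continuousAt.eventually
        (lt_mem_nhds h5) |>.and (lt_mem_nhds h1)).filter_mono nhdsWithin_le_nhds
    obtain ⟨y, ⟨h7, h8⟩, h9⟩ := (h6.and self_mem_nhdsWithin).exists
    exact eventually_lt_log_card_div hd hinv hsum hψ hβ h9 h2 h7 V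
      fun n ω hω hω' => hV n ω (h8.trans hω) hω'
  have hpos : ∀ᶠ n in atTop, 0 < (V n).card :=
    (hlower (l - 1) (by linarith)).mono fun n hn => hn.1
  refine ⟨hpos, tendsto_order.2 ⟨fun l' hl' => (hlower l' hl').mono fun n hn => hn.2,
    fun l' hl' => ?_⟩⟩
  obtain ⟨_, ⟨β, hβ, rfl⟩, hβl⟩ := (isGLB_lt_iff hl).1 hl'
  filter_upwards [hpos, ((tendsto_finitePressure hinv hsum hβ).const_sub (β * v)).eventually
    (gt_mem_nhds hβl)] with n h1 h2
  refine lt_of_le_of_lt ?_ h2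
  have hN := card_box_pos d n
  have h3 := card_le_exp_mul_partitionFunction Φ (le_of_lt hβ) (hle n)
  have h4 := Real.log_le_log (by exact_mod_cast h1) h3
  rw [partitionFunction_box_eq_exp, ← Real.exp_add, Real.log_exp] at h4
  rw [div_le_iff₀ hN]
  linarith

end LargeDeviations

/-! ### Extended real valued rates -/

/-- Positivity is needed because `Real.log 0 = 0`, whereas `ENNReal.log 0 = ⊥`. -/
lemma tendsto_ennrealLog_div {c : ℕ → ℕ} {N : ℕ → ℝ} {l : ℝ} (hc : ∀ᶠ n in atTop, 0 < c n)
    (h : Tendsto (fun n => Real.log (c n) / N n) atTop (𝓝 l)) :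
    Tendsto (fun n => ENNReal.log (c n : ENNReal) / (N n : EReal)) atTop (𝓝 (l : EReal)) := by
  refine ((continuous_coe_real_ereal.tendsto l).comp h).congr' ?_
  filter_upwards [hc] with n hn
  have h1 : (c n : ENNReal) = ENNReal.ofReal (c n) := by simp
  rw [h1, ENNReal.log_ofReal_of_pos (by exact_mod_cast hn), ← EReal.coe_div]
  rfl

lemma logEnergyMeasure_eq (Φ : Potential d S) (n : ℕ) (B : Set ℝ)
    (V : Finset (Config S (box d n)))
    (hV : ∀ ω, ω ∈ V ↔ hamiltonian Φ (box d n) ω / ((box d n).card : ℝ) ∈ B) :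
    logEnergyMeasure Φ n B =
      ENNReal.log (V.card : ENNReal) / (((box d n).card : ℝ) : EReal) := by
  have h : {ω : Config S (box d n) | hamiltonian Φ (box d n) ω / ((box d n).card : ℝ) ∈ B} = V := by
    ext ω
    simp [hV]
  rw [logEnergyMeasure, h, Set.encard_coe_eq_coe_finsetCard, ENat.toENNReal_coe]

lemma logEuler_eq [Finite S] [TopologicalSpace S] [DiscreteTopology S] (Φ : Potential d S)
    (n : ℕ) (u : ℝ) (V : Finset (Config S (box d n)))
    (hV : ∀ ω, ω ∈ V ↔ hamiltonian Φ (box d n) ω ≤ ((box d n).card : ℝ) * u) :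
    logEuler Φ n u = ENNReal.log (V.card : ENNReal) / (((box d n).card : ℝ) : EReal) := by
  have h : sublevel Φ (box d n) u = V := by
    ext ω
    simp [sublevel, hV]
  rw [logEuler, eulerChar_eq_card, Int.natAbs_natCast, Nat.card_coe_set_eq, h,
    Set.ncard_coe_finset]

/-! ### Energy windows below a given level -/

lemma exists_deriv_mem_window {ψ : ℝ → ℝ} {a b w v : ℝ} {h : ℝ → ℝ}
    (hanti : StrictAntiOn (deriv ψ) (Ioi 0)) (hmaps : MapsTo (deriv ψ) (Ioi 0) (Ioo a b))
    (hh : MapsTo h (Ioo a b) (Ioi 0)) (hinv : ∀ u ∈ Ioo a b, deriv ψ (h u) = u)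
    (hcont : ∀ u ∈ Ioo a b, ContinuousAt h u) (hab : a < b) (hav : a < v) (hwb : w < b)
    (hwv : w < v) {η : ℝ} (hη : 0 < η) :
    ∃ β > 0, w < deriv ψ β ∧ deriv ψ β < v ∧ β * (v - deriv ψ β) < η := by
  rcases lt_or_ge v b with hvb | hbv
  · have h1 : Tendsto (fun u => h u * (v - u)) (𝓝[<] v) (𝓝 0) := by
      have : Tendsto (fun u => h u * (v - u)) (𝓝 v) (𝓝 (h v * (v - v))) :=
        (hcont v ⟨hav, hvb⟩).tendsto.mul ((continuous_const.sub continuous_id).tendsto v)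
      rw [sub_self, mul_zero] at this
      exact this.mono_left nhdsWithin_le_nhds
    obtain ⟨u, ⟨hu1, hu2⟩, hu3⟩ := ((h1.eventually (gt_mem_nhds hη)).and
      (((lt_mem_nhds hwv).and (lt_mem_nhds hav)).filter_mono nhdsWithin_le_nhds)).and
      self_mem_nhdsWithin |>.exists
    have hu : u ∈ Ioo a b := ⟨hu2.2, lt_trans hu3 hvb⟩
    refine ⟨h u, hh hu, ?_⟩
    rw [hinv u hu]
    exact ⟨hu2.1, hu3, hu1⟩
  -- Above the interval no density near `v` is available, but the loss `β * (v - ψ' β)` becomes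
  -- small by letting `β` tend to zero.
  · obtain ⟨u, hu1, hu2⟩ := exists_between (max_lt hab hwb)
    have hu : u ∈ Ioo a b := ⟨(le_max_left _ _).trans_lt hu1, hu2⟩
    have hvu : 0 < v - u := by linarith
    have hβ0 : 0 < h u := hh hu
    obtain ⟨β, hβ, hβ'⟩ := exists_between (lt_min hβ0 (div_pos hη hvu))
    have h1 : u < deriv ψ β := by
      have := hanti (mem_Ioi.2 hβ) hβ0 (hβ'.trans_le (min_le_left _ _))
      rwa [hinv u hu] at this
    refine ⟨β, hβ, (le_max_right _ _).trans_lt (hu1.trans h1), (hmaps hβ).2.trans_le hbv, ?_⟩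
    have h2 := hβ'.trans_le (min_le_right _ _)
    rw [lt_div_iff₀ hvu] at h2
    nlinarith

/-- The tangent at `β` bounds the conjugate below by `β ψ'(β) - ψ(β)`. This also covers levels `v ≥
b`, where the infimum need not be attained. -/
lemma exists_isGLB_conjugate {ψ : ℝ → ℝ} (hψ : ∀ x, 0 < x → DifferentiableAt ℝ ψ x)
    (hc : ∀ B, 0 < B → ∃ c > 0, ConcaveOn ℝ (Ioo 0 B) fun x => ψ x + c * x ^ 2)
    {β v : ℝ} (hβ : 0 < β) (hv : deriv ψ β ≤ v) :
    ∃ l, IsGLB ((fun β => β * v - ψ β) '' Ioi 0) l := by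
  refine ⟨_, isGLB_csInf ⟨_, 1, by simp, rfl⟩ ⟨β * deriv ψ β - ψ β, ?_⟩⟩
  rintro _ ⟨γ, hγ, rfl⟩
  have h1 := le_tangent_of_stronglyConcave hψ hc hβ hγ
  have h2 := mul_le_mul_of_nonneg_left hv (le_of_lt hγ)
  simp only
  linarith

lemma NonConstant.nonempty {Φ : Potential d S} (h : NonConstant Φ) : Nonempty S := by
  obtain ⟨A, ⟨x, hx⟩, ω, -⟩ := h
  exact ⟨ω ⟨x, hx⟩⟩

end LatticeSpin

end

/-! ### The main theorem -/

open LatticeSpin in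
theorem mainTheorem1 (d : ℕ) (hd : 0 < d) (S : Type*) [Fintype S] [TopologicalSpace S]
    [DiscreteTopology S] (Φ : LatticeSpin.Potential d S)
    (hinv : LatticeSpin.TranslationInvariant Φ) (hsum : LatticeSpin.AbsolutelySummable Φ)
    (hconst : LatticeSpin.NonConstant Φ) (hcorr : LatticeSpin.PositivelyCorrelated Φ)
    (hfirst : ∀ β : ℝ, 0 < β → ¬ LatticeSpin.PhaseTransition Φ 1 β) :
    ∃ (a b : ℝ) (s σ : ℝ → ℝ), a < b ∧
      -- the limits that define the pressure, the entropy and the Euler density exist, and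
      -- the last two are the finite numbers `s u` and `σ u`
      (∀ β : ℝ, 0 < β → Tendsto (fun n => LatticeSpin.finitePressure Φ n β) atTop
        (𝓝 (LatticeSpin.pressure Φ β))) ∧
      (∀ u ∈ Ioo a b,
        (∀ r : ℝ, 0 < r →
          Tendsto (fun n => LatticeSpin.logEnergyMeasure Φ n (Ioo (u - r) (u + r))) atTop
            (𝓝 (LatticeSpin.energyRate Φ (Ioo (u - r) (u + r))))) ∧
        Tendsto (fun r => LatticeSpin.energyRate Φ (Ioo (u - r) (u + r))) (𝓝[>] (0 : ℝ))
          (𝓝 (LatticeSpin.entropy Φ u)) ∧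
        LatticeSpin.entropy Φ u = (s u : EReal)) ∧
      (∀ u ∈ Ioo a b,
        Tendsto (fun n => LatticeSpin.logEuler Φ n u) atTop
          (𝓝 (LatticeSpin.eulerDensity Φ u)) ∧
        LatticeSpin.eulerDensity Φ u = (σ u : EReal)) ∧
      -- (i) differentiability, Legendre-Fenchel duality, mutually inverse continuous derivatives
      DifferentiableOn ℝ (LatticeSpin.pressure Φ) (Ioi 0) ∧
      DifferentiableOn ℝ s (Ioo a b) ∧
      (∀ β : ℝ, 0 < β →
        IsGLB ((fun u => β * u - s u) '' Ioo a b) (LatticeSpin.pressure Φ β)) ∧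
      (∀ u ∈ Ioo a b,
        IsGLB ((fun β => β * u - LatticeSpin.pressure Φ β) '' Ioi 0) (s u)) ∧
      ContinuousOn (deriv (LatticeSpin.pressure Φ)) (Ioi 0) ∧
      ContinuousOn (deriv s) (Ioo a b) ∧
      MapsTo (deriv (LatticeSpin.pressure Φ)) (Ioi 0) (Ioo a b) ∧
      MapsTo (deriv s) (Ioo a b) (Ioi 0) ∧
      InvOn (deriv s) (deriv (LatticeSpin.pressure Φ)) (Ioi 0) (Ioo a b) ∧
      -- (ii) the Euler density is the entropy
      (∀ u ∈ Ioo a b, σ u = s u) ∧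
      -- (iii) transitions of order two
      (∀ u ∈ Ioo a b, ∀ β : ℝ, 0 < β → β = deriv s u →
        (LatticeSpin.PhaseTransition Φ 2 β ↔
          ¬ LatticeSpin.TimesDifferentiableAt 2 σ u ∨ iteratedDeriv 2 σ u = 0)) ∧
      -- (iv) transitions of order greater than two
      (∀ u ∈ Ioo a b, ∀ β : ℝ, 0 < β → β = deriv s u → ∀ p : ℕ, 2 < p →
        (LatticeSpin.PhaseTransition Φ p β ↔
          LatticeSpin.TimesDifferentiableAt (p - 1) σ u ∧
            ¬ LatticeSpin.TimesDifferentiableAt p σ u ∧ iteratedDeriv 2 σ u ≠ 0)) := by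
  classical
  have := hconst.nonempty
  set ψ := pressure Φ with hψdef
  have hψ : ∀ β, 0 < β → DifferentiableAt ℝ ψ β := fun β hβ => by
    by_contra hcon
    exact hfirst β hβ ⟨hβ, le_rfl, trivial, fun h => hcon (TimesDifferentiableAt.one_iff.1 h)⟩
  have hc : ∀ B, 0 < B → ∃ c > 0, ConcaveOn ℝ (Ioo 0 B) fun x => ψ x + c * x ^ 2 :=
    fun B _ => exists_concaveOn_pressure_add hinv hsum hconst hcorr B
  obtain ⟨a, b, h, hab, hmaps, hh, hinvOn, hcg, hch⟩ :=
    exists_inverse_deriv_of_stronglyConcave hψ hc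
      ⟨siteNorm Φ, fun β hβ => abs_deriv_pressure_le hinv hsum hβ⟩
  have hgh : ∀ u ∈ Ioo a b, deriv ψ (h u) = u := hinvOn.2
  have hhg : ∀ β, 0 < β → h (deriv ψ β) = β := hinvOn.1
  have hh0 : ∀ u ∈ Ioo a b, 0 < h u := hh
  have hanti := strictAntiOn_deriv_of_stronglyConcave hψ hc
  set s : ℝ → ℝ := fun v => h v * v - ψ (h v) with hs
  have hsd : ∀ u ∈ Ioo a b, HasDerivAt s (h u) u := fun u hu =>
    hasDerivAt_legendre hψ hc hh hgh hu (hch u hu)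
  have hs' : ∀ u ∈ Ioo a b, deriv s u = h u := fun u hu => (hsd u hu).deriv
  have hsleast : ∀ u ∈ Ioo a b, ∀ β, 0 < β → s u ≤ β * u - ψ β := fun u hu β hβ => by
    have := le_tangent_of_stronglyConcave hψ hc (hh0 u hu) hβ
    rw [hgh u hu] at this
    simp only [hs]
    linarith
  have hsglb : ∀ u ∈ Ioo a b, IsGLB ((fun β => β * u - ψ β) '' Ioi 0) (s u) := fun u hu =>
    IsLeast.isGLB ⟨⟨h u, hh hu, rfl⟩, by rintro _ ⟨β, hβ, rfl⟩; exact hsleast u hu β hβ⟩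
  have hwin : ∀ v w, a < v → w < b → w < v → ∀ η > 0, ∃ β > 0, w < deriv ψ β ∧
      deriv ψ β < v ∧ β * (v - deriv ψ β) < η := fun v w hav hwb hwv η hη =>
    exists_deriv_mem_window hanti hmaps hh hgh hch hab hav hwb hwv hη
  have hglb : ∀ v, a < v → ∃ l, IsGLB ((fun β => β * v - ψ β) '' Ioi 0) l := fun v hv => by
    obtain ⟨β, hβ, -, h2, -⟩ := hwin v (min (v - 1) (b - 1)) hv
      ((min_le_right _ _).trans_lt (by linarith)) ((min_le_left _ _).trans_lt (by linarith)) 1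
      one_pos
    exact exists_isGLB_conjugate hψ hc hβ h2.le
  -- `S'` extends `s` to all `v > a`, since the upper end `u + r` of an energy window may lie beyond
  -- `b`.
  choose! S' hS' using hglb
  have hS's : ∀ u ∈ Ioo a b, S' u = s u := fun u hu => (hS' u hu.1).unique (hsglb u hu)
  -- As only `β > 0` occurs, the count in a window is governed by its upper end; the lower end plays
  -- no role in the rate.
  have henergy : ∀ u ∈ Ioo a b, ∀ r : ℝ, 0 < r →
      Tendsto (fun n => logEnergyMeasure Φ n (Ioo (u - r) (u + r))) atTop
        (𝓝 ((S' (u + r) : ℝ) : EReal)) := by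
    intro u hu r hr
    have hav : a < u + r := by linarith [hu.1]
    obtain ⟨h1, h2⟩ := tendsto_log_card_div hd hinv hsum hψ (w := u - r) (v := u + r)
      (fun n => Finset.univ.filter fun ω : Config S (box d n) =>
        hamiltonian Φ (box d n) ω / ((box d n).card : ℝ) ∈ Ioo (u - r) (u + r))
      (fun n ω hω => by
        have h3 := (Finset.mem_filter.1 hω).2.2
        rw [div_lt_iff₀ (card_box_pos d n)] at h3
        linarith)
      (fun n ω h3 h4 => Finset.mem_filter.2 ⟨Finset.mem_univ _, h3, h4⟩)
      (hS' _ hav) (hwin _ _ hav (by linarith [hu.2]) (by linarith))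
    exact (tendsto_ennrealLog_div h1 h2).congr fun n =>
      (logEnergyMeasure_eq Φ n _ _ fun ω => by simp).symm
  have hrate : ∀ u ∈ Ioo a b, ∀ r : ℝ, 0 < r →
      energyRate Φ (Ioo (u - r) (u + r)) = ((S' (u + r) : ℝ) : EReal) :=
    fun u hu r hr => (henergy u hu r hr).limUnder_eq
  have hentropy : ∀ u ∈ Ioo a b, Tendsto (fun r => energyRate Φ (Ioo (u - r) (u + r)))
      (𝓝[>] (0 : ℝ)) (𝓝 (s u : EReal)) := by
    intro u hu
    have h1 : Tendsto (fun r => s (u + r)) (𝓝[>] (0 : ℝ)) (𝓝 (s u)) := by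
      have h2 : Tendsto (fun r => u + r) (𝓝 (0 : ℝ)) (𝓝 u) := by
        simpa using (continuous_const.add continuous_id).tendsto (0 : ℝ) (f := fun r => u + r)
      exact ((hsd u hu).continuousAt.tendsto.comp h2).mono_left nhdsWithin_le_nhds
    refine ((continuous_coe_real_ereal.tendsto _).comp h1).congr' ?_
    filter_upwards [Ioo_mem_nhdsGT (sub_pos.2 hu.2)] with r hr
    rw [hrate u hu r hr.1, hS's (u + r) ⟨by linarith [hu.1, hr.1], by linarith [hr.2]⟩]
    rfl
  have heuler : ∀ u ∈ Ioo a b, Tendsto (fun n => logEuler Φ n u) atTop (𝓝 (s u : EReal)) := by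
    intro u hu
    obtain ⟨h1, h2⟩ := tendsto_log_card_div hd hinv hsum hψ (w := u - 1) (v := u)
      (fun n => Finset.univ.filter fun ω : Config S (box d n) =>
        hamiltonian Φ (box d n) ω ≤ ((box d n).card : ℝ) * u)
      (fun n ω hω => (Finset.mem_filter.1 hω).2)
      (fun n ω _ h4 => Finset.mem_filter.2 ⟨Finset.mem_univ _, by
        rw [div_lt_iff₀ (card_box_pos d n)] at h4
        linarith⟩)
      (hsglb u hu) (hwin _ _ hu.1 (by linarith [hu.2]) (by linarith))
    exact (tendsto_ennrealLog_div h1 h2).congr fun n =>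
      (logEuler_eq Φ n u _ fun ω => by simp).symm
  -- Peeling off one derivative reduces this to the inverse functions `ψ'` and `h = s'`. Parts (iii)
  -- and (iv) then follow by propositional logic from consecutive values of `k`.
  have hequiv : ∀ u ∈ Ioo a b, ∀ k : ℕ, TimesDifferentiableAt (k + 2) ψ (h u) ↔
      TimesDifferentiableAt (k + 2) s u ∧ iteratedDeriv 2 s u ≠ 0 := by
    intro u hu k
    have hnu : ∀ᶠ v in 𝓝 u, v ∈ Ioo a b := Ioo_mem_nhds hu.1 hu.2
    have hnβ : ∀ᶠ β in 𝓝 (h u), 0 < β := lt_mem_nhds (hh0 u hu)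
    have hds : deriv s =ᶠ[𝓝 u] h := hnu.mono hs'
    rw [TimesDifferentiableAt.succ_succ_iff, TimesDifferentiableAt.succ_succ_iff,
      TimesDifferentiableAt.congr_iff hds, iteratedDeriv_succ, iteratedDeriv_one, hds.deriv_eq,
      and_iff_right (hnβ.mono fun β hβ => hψ β hβ),
      and_iff_right (hnu.mono fun v hv => (hsd v hv).differentiableAt)]
    exact TimesDifferentiableAt.iff_of_local_inverse rfl (hgh u hu) (hnβ.mono hcg)
      (hnu.mono hch) (hnu.mono hgh) (hnβ.mono hhg)
      fun hd' => deriv_deriv_ne_zero_of_stronglyConcave hψ hc (hh0 u hu) hd'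
  refine ⟨a, b, s, s, hab, fun β hβ => tendsto_finitePressure hinv hsum hβ, fun u hu =>
    ⟨fun r hr => ?_, ?_, (hentropy u hu).limUnder_eq⟩, fun u hu => ⟨?_, (heuler u hu).limUnder_eq⟩,
    fun β hβ => (hψ β hβ).differentiableWithinAt,
    fun u hu => (hsd u hu).differentiableAt.differentiableWithinAt, fun β hβ => ?_, hsglb,
    fun β hβ => (hcg β hβ).continuousWithinAt,
    fun u hu => ((hch u hu).congr ?_).continuousWithinAt, hmaps, fun u hu => ?_, ⟨?_, ?_⟩,
    fun _ _ => rfl, ?_, ?_⟩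
  · rw [hrate u hu r hr]
    exact henergy u hu r hr
  · rw [show entropy Φ u = s u from (hentropy u hu).limUnder_eq]
    exact hentropy u hu
  · rw [show eulerDensity Φ u = s u from (heuler u hu).limUnder_eq]
    exact heuler u hu
  · refine IsLeast.isGLB ⟨⟨deriv ψ β, hmaps hβ, ?_⟩, ?_⟩
    · simp only [hs, hhg β hβ]
      ring
    · rintro _ ⟨u, hu, rfl⟩
      have := hsleast u hu β hβ
      simp only
      linarith
  · filter_upwards [Ioo_mem_nhds hu.1 hu.2] with v hv using (hs' v hv).symm
  · rw [hs' u hu]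
    exact hh hu
  · intro β hβ
    rw [hs' _ (hmaps hβ)]
    exact hhg β hβ
  · intro u hu
    rw [hs' u hu]
    exact hgh u hu
  · rintro u hu _ hβ rfl
    rw [hs' u hu] at hβ ⊢
    have hlogic : ∀ {A B P Q R T : Prop}, A → B → P → (Q ↔ R ∧ ¬T) →
        ((A ∧ B ∧ P ∧ ¬Q) ↔ (¬R ∨ T)) := by tauto
    exact hlogic hβ one_le_two (TimesDifferentiableAt.one_iff.2 (hψ _ hβ)) (hequiv u hu 0)
  · rintro u hu _ hβ rfl p hp
    rw [hs' u hu] at hβ ⊢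
    obtain ⟨k, rfl⟩ := Nat.exists_eq_add_of_le' (show 3 ≤ p from hp)
    have hlogic : ∀ {A B P Q P' Q' T : Prop}, A → B → (P ↔ P' ∧ T) → (Q ↔ Q' ∧ T) →
        ((A ∧ B ∧ P ∧ ¬Q) ↔ (P' ∧ ¬Q' ∧ T)) := by tauto
    exact hlogic hβ (show 1 ≤ k + 3 by omega) (hequiv u hu k) (hequiv u hu (k + 1))
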